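/- Throughout, varieties may be infinitary, have a set of operations and a set of equations, and their algebras may have empty carriers. A topos is a cartesian closed category with pullbacks and a subobject classifier; it is non-degenerate if its terminal object $1$ is not initial. The two-valued collapse $\mathcal{C}_{\mathrm{tv}}$ of a cartesian closed category $\mathcal{C}$ is the full subcategory of those objects $Y$ that are initial or for which $Y \to 1$ is an epimorphism. Let $\mathcal{C}$ be a many-sorted variety which is also a non-degenerate topos, and let $X \in \mathcal{C}$ be the free algebra on one generator of each sort. Then: (1) $X$ lies in $\mathcal{C}_{\mathrm{tv}}$, and there are a single-sorted cartesian closed variety $\mathcal{V}$ and an equivalence $\mathcal{C}_{\mathrm{tv}} \simeq \mathcal{V}$ which sends $X$ to a free $\mathcal{V}$-algebra on one generator. (2) There is a non-degenerate Grothendieck matched pair of algebras $\langle B_{\mathcal{J}} \mid M\rangle$, defined from $X$ as follows, such that $\mathcal{C}_{\mathrm{tv}}$ is equivalent to the category $\langle B_{\mathcal{J}} \mid M\rangle\text{-}\mathbf{Set}$ of its sets: - $M = \mathcal{C}(X,X)$, with unit $\mathrm{id}_X$ and with $mn$ being $m$ followed by $n$; - $B = \mathcal{C}(X, 1+1)$,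 where, with coproduct injections $\iota_\top,\iota_\bot : 1 \to 1+1$, the top element is $X \to 1 \xrightarrow{\iota_\top} 1+1$, the complement $b'$ is $b$ followed by the map exchanging $\iota_\top$ and $\iota_\bot$, and $b \wedge c$ is $(b,c) : X \to (1+1)\times(1+1)$ followed by the map $\wedge : (1+1)\times(1+1) \to 1+1$ with $\wedge\circ(\iota_i \times \iota_j) = \iota_{i\wedge j}$; - a subset $P \subseteq B \setminus \{0\}$ is in $\mathcal{J}$ just when there is a map $f : X \to P\cdot 1$ into the $P$-fold copower of $1$ such that $\langle \delta_{bc}\rangle_{b \in P} \circ f = c$ for all $c \in P$, where $\delta_{bc} = \iota_\top$ if $b = c$ and $\delta_{bc} = \iota_\bot$ otherwise; - $M$ acts on $B$ by precomposition, $m^\ast b = b \circ m$; - $B$ acts on $M$ by letting $b(m,n)$ be the composite $X \xrightarrow{(b,\mathrm{id})} (1+1)\times X \cong X + X \xrightarrow{\langle m,n\rangle} X$. Here a Grothendieck matched pair $\langle B_{\mathcal{J}} \mid M\rangle$ consists of a Boolean algebra $B$ with $0 \neq 1$; a collection $\mathcal{J}$ of partitions of $B$ (sets of non-zero, pairwise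 disjoint elements with join $1$) which contains all finite ones, is closed under refining each member $b$ of a partition in $\mathcal{J}$ by a partition in $\mathcal{J}$ (and dropping zeros), and under amalgamating the members of a partition in $\mathcal{J}$ along any surjection onto a set, the joins required for this existing; a monoid $M$; a $B_{\mathcal{J}}$-set structure on $M$; and an action $(m,b) \mapsto m^\ast b$ of $M$ on $B$ by Boolean homomorphisms with $\{m^\ast b : b \in P\}\setminus\{0\} \in \mathcal{J}$ for $P \in \mathcal{J}$; such that $b(m,n)p = b(mp,np)$, $m(b(n,p)) = (m^\ast b)(mn,mp)$ and $b(m,n)^\ast c = (b \wedge m^\ast c)\vee(b'\wedge n^\ast c)$. A $B_{\mathcal{J}}$-set is a set $Y$ with an operation $(b,x,y) \mapsto b(x,y)$, $B \times Y \times Y \to Y$, such that $b(x,x)=x$, $b(b(x,y),z)=b(x,z)=b(x,b(y,z))$, $1(x,y)=x$, $b'(x,y)=b(y,x)$, $(b\wedge c)(x,y)=b(c(x,y),y)$, and for each infinite $P \in \mathcal{J}$ an operation $P : Y^P \to Y$ such that $P(\lambda b.\,x)=x$, $P(\lambda b.\,b(x_b,y_b))=P(\lambda b.\,x_b)$ and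 $b(P(x),x_b)=x_b$ for $b \in P$. A $\langle B_{\mathcal{J}} \mid M\rangle$-set is a $B_{\mathcal{J}}$-set $Y$ with a left action of $M$ such that $b(m,n)\cdot x = b(m\cdot x,n\cdot x)$ and $m\cdot b(x,y) = (m^\ast b)(m\cdot x,m\cdot y)$; homomorphisms are the functions preserving all of this structure. -/

import Mathlib

open CategoryTheory Limits MonoidalCategory CartesianMonoidalCategory

universe u v w

noncomputable section

/-! ### Many-sorted (possibly infinitary) varieties -/

/-- A many-sorted signature with set of sorts `S`; operations may have infinite arity. -/
structure Signature (S : Type u) where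
  /-- operation symbols -/
  Op : Type u
  /-- argument places of an operation symbol -/
  Arg : Op → Type u
  /-- sort of each argument place -/
  dom : ∀ o, Arg o → S
  /-- sort of the result -/
  cod : Op → S

/-- Terms over a signature in a sorted family `G` of variables. -/
inductive Signature.Term {S : Type u} (F : Signature S) (G : S → Type u) : S → Type u
  | var {s : S} (x : G s) : Signature.Term F G s
  | app (o : F.Op) (a : ∀ i : F.Arg o, Signature.Term F G (F.dom o i)) :
      Signature.Term F G (F.cod o)

/-- The value of a term under a valuation of the variables in a family of sets with operations. -/
def Signature.Term.eval {S : Type u} {F : Signature S} {G A : S → Type u}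
    (op : ∀ o : F.Op, (∀ i, A (F.dom o i)) → A (F.cod o)) (v : ∀ s, G s → A s) :
    ∀ {s : S}, F.Term G s → A s
  | _, .var x => v _ x
  | _, .app o a => op o fun i => (a i).eval op v

/-- An `S`-sorted equational theory: a signature together with a set of equations, each between
two terms of the same sort in a sorted context of variables. -/
structure Theory (S : Type u) extends Signature S where
  Eqn : Type u
  ctx : Eqn → S → Type u
  sort : Eqn → S
  lhs : ∀ e, toSignature.Term (ctx e) (sort e)
  rhs : ∀ e, toSignature.Term (ctx e) (sort e)

/-- The algebras (models) of a theory. The carriers are allowed to be empty. -/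
structure Theory.Alg {S : Type u} (T : Theory S) where
  carrier : S → Type u
  op : ∀ o : T.Op, (∀ i, carrier (T.dom o i)) → carrier (T.cod o)
  eqn : ∀ (e : T.Eqn) (v : ∀ s, T.ctx e s → carrier s),
    (T.lhs e).eval op v = (T.rhs e).eval op v

namespace Theory

variable {S : Type u} {T : Theory S}

/-- Homomorphisms of algebras. -/
@[ext]
structure Hom (A B : T.Alg) where
  map : ∀ s, A.carrier s → B.carrier s
  map_op : ∀ (o : T.Op) (a : ∀ i, A.carrier (T.dom o i)),
    map _ (A.op o a) = B.op o fun i => map _ (a i)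

/-- The variety of `T`-algebras, as a category. -/
instance : Category.{u} T.Alg where
  Hom := Hom
  id A := ⟨fun _ x => x, fun _ _ => rfl⟩
  comp f g := ⟨fun s x => g.map s (f.map s x), fun o a => by rw [f.map_op, g.map_op]⟩

@[ext]
theorem Alg.hom_ext {A B : T.Alg} {f g : A ⟶ B} (h : ∀ s x, f.map s x = g.map s x) : f = g :=
  Hom.ext (funext fun s => funext fun x => h s x)

@[simp] theorem Alg.id_map (A : T.Alg) (s : S) (x : A.carrier s) :
    Hom.map (𝟙 A) s x = x := rfl

@[simp] theorem Alg.comp_map {A B C : T.Alg} (f : A ⟶ B) (g : B ⟶ C) (s : S) (x : A.carrier s) :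
    Hom.map (f ≫ g) s x = g.map s (f.map s x) := rfl

/-- `X` is free on the family `g` consisting of one generator of each sort. -/
def IsFreeOnOneOfEachSort (X : T.Alg) (g : ∀ s, X.carrier s) : Prop :=
  ∀ (Y : T.Alg) (y : ∀ s, Y.carrier s), ∃! f : X ⟶ Y, ∀ s, f.map s (g s) = y s

/-! #### Finite products of algebras -/

/-- Homomorphisms commute with the evaluation of terms. -/
theorem eval_hom {F : Signature S} {G A B : S → Type u}
    {opA : ∀ o : F.Op, (∀ i, A (F.dom o i)) → A (F.cod o)}
    {opB : ∀ o : F.Op, (∀ i, B (F.dom o i)) → B (F.cod o)}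
    (f : ∀ s, A s → B s) (hf : ∀ o a, f _ (opA o a) = opB o fun i => f _ (a i))
    (v : ∀ s, G s → A s) {s : S} (t : F.Term G s) :
    f s (t.eval opA v) = t.eval opB fun s x => f s (v s x) := by
  induction t with
  | var x => rfl
  | app o a ih =>
    simp only [Signature.Term.eval, hf]
    congr 1
    funext i
    exact ih i

variable (T) in
/-- The one-element algebra. -/
def Alg.one : T.Alg where
  carrier _ := PUnit
  op _ _ := ⟨⟩
  eqn _ _ := rfl

/-- The product of two algebras. -/
def Alg.prod (A B : T.Alg) : T.Alg where
  carrier s := A.carrier s × B.carrier s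
  op o a := (A.op o fun i => (a i).1, B.op o fun i => (a i).2)
  eqn e v := by
    refine Prod.ext ?_ ?_
    · have h := fun {s : S} (t : T.Term (T.ctx e) s) => eval_hom
        (F := T.toSignature) (A := fun s => A.carrier s × B.carrier s) (B := A.carrier)
        (opA := fun o a => (A.op o fun i => (a i).1, B.op o fun i => (a i).2)) (opB := A.op)
        (fun _ x => x.1) (fun _ _ => rfl) v t
      exact (h _).trans ((A.eqn e _).trans (h _).symm)
    · have h := fun {s : S} (t : T.Term (T.ctx e) s) => eval_hom
        (F := T.toSignature) (A := fun s => A.carrier s × B.carrier s) (B := B.carrier)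
        (opA := fun o a => (A.op o fun i => (a i).1, B.op o fun i => (a i).2)) (opB := B.op)
        (fun _ x => x.2) (fun _ _ => rfl) v t
      exact (h _).trans ((B.eqn e _).trans (h _).symm)

def Alg.prodFst (A B : T.Alg) : A.prod B ⟶ A := Hom.mk (fun _ x => x.1) fun _ _ => rfl

def Alg.prodSnd (A B : T.Alg) : A.prod B ⟶ B := Hom.mk (fun _ x => x.2) fun _ _ => rfl

def Alg.prodLift {A B C : T.Alg} (f : C ⟶ A) (g : C ⟶ B) : C ⟶ A.prod B :=
  Hom.mk (fun s x => (f.map s x, g.map s x)) fun o a =>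
    Prod.ext (f.map_op o a) (g.map_op o a)

/-- The cartesian monoidal structure given by the pointwise products of algebras. -/
instance : CartesianMonoidalCategory T.Alg :=
  .ofChosenFiniteProducts
    ⟨asEmptyCone (Alg.one T), IsTerminal.ofUniqueHom
      (fun _ => Hom.mk (fun _ _ => ⟨⟩) fun _ _ => rfl) fun _ _ => rfl⟩
    fun A B => ⟨BinaryFan.mk (A.prodFst B) (A.prodSnd B),
      BinaryFan.isLimitMk (fun s => Alg.prodLift (A := A) (B := B) s.fst s.snd)
        (fun _ => rfl) (fun _ => rfl)
        (fun s _ h₁ h₂ => Alg.hom_ext fun t x => Prod.ext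
          (congrArg (fun f : s.pt ⟶ A => Hom.map f t x) h₁)
          (congrArg (fun f : s.pt ⟶ B => Hom.map f t x) h₂))⟩

/-! #### Algebras given by generators and relations, and coproducts of algebras -/

/-- The congruence on terms in the generators `G` generated by the relations `R`
and the equations of `T`. -/
inductive Con (T : Theory S) (G : S → Type u) (R : ∀ s, T.Term G s → T.Term G s → Prop) :
    ∀ s, T.Term G s → T.Term G s → Prop
  | rel {s t t'} (h : R s t t') : Con T G R s t t'
  | eqn (e : T.Eqn) (v : ∀ s, T.ctx e s → T.Term G s) :
      Con T G R _ ((T.lhs e).eval .app v) ((T.rhs e).eval .app v)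
  | refl {s} (t : T.Term G s) : Con T G R s t t
  | symm {s t t'} (h : Con T G R s t t') : Con T G R s t' t
  | trans {s t t' t''} (h : Con T G R s t t') (h' : Con T G R s t' t'') : Con T G R s t t''
  | app (o : T.Op) (a b : ∀ i : T.Arg o, T.Term G (T.dom o i))
      (h : ∀ i, Con T G R _ (a i) (b i)) : Con T G R _ (.app o a) (.app o b)

section Present

variable (G : S → Type u) (R : ∀ s, T.Term G s → T.Term G s → Prop)

/-- The congruence generated by `R` as a setoid. -/
def conSetoid (s : S) : Setoid (T.Term G s) where
  r := Con T G R s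
  iseqv := ⟨.refl, .symm, .trans⟩

/-- The operations on classes of terms. -/
def presentOp (o : T.Op) (a : ∀ i, Quotient (conSetoid G R (T.dom o i))) :
    Quotient (conSetoid G R (T.cod o)) :=
  Quotient.mk _ (.app o fun i => (a i).out)

theorem presentOp_mk (o : T.Op) (a : ∀ i : T.Arg o, T.Term G (T.dom o i)) :
    presentOp G R o (fun i => Quotient.mk _ (a i)) = Quotient.mk _ (.app o a) :=
  Quotient.sound (s := conSetoid G R _) (.app _ _ _ fun i =>
    Quotient.mk_out (s := conSetoid G R _) (a i))

/-- The algebra presented by generators `G` and relations `R`. -/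
def present : T.Alg where
  carrier s := Quotient (conSetoid G R s)
  op := presentOp G R
  eqn e v := by
    have key : ∀ {s} (t : T.Term (T.ctx e) s), t.eval (presentOp G R) v =
        Quotient.mk (conSetoid G R s) (t.eval .app fun s x => (v s x).out) := by
      intro s t
      rw [eval_hom (opB := presentOp G R) (fun s t => Quotient.mk (conSetoid G R s) t)
        fun o a => (presentOp_mk G R o a).symm]
      simp
    rw [key, key]
    exact Quotient.sound (s := conSetoid G R _) (.eqn e _)

variable {G R}

/-- The homomorphism out of `present G R` induced by a valuation satisfying the relations. -/
def presentDesc (A : T.Alg) (v : ∀ s, G s → A.carrier s)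
    (h : ∀ s t t', R s t t' → t.eval A.op v = t'.eval A.op v) : present G R ⟶ A :=
  have hc : ∀ s t t', Con T G R s t t' → t.eval A.op v = t'.eval A.op v := by
    intro s t t' c
    induction c with
    | rel r => exact h _ _ _ r
    | eqn e w =>
      have h := fun {s : S} (t : T.Term (T.ctx e) s) => eval_hom (opA := .app) (opB := A.op)
        (fun s (t : T.Term G s) => t.eval A.op v) (fun _ _ => rfl) w t
      exact (h _).trans ((A.eqn e _).trans (h _).symm)
    | refl => rfl
    | symm _ ih => exact ih.symm
    | trans _ _ ih ih' => exact ih.trans ih'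
    | app o a b _ ih =>
      simp only [Signature.Term.eval]
      congr 1
      funext i
      exact ih i
  Hom.mk (fun s => Quotient.lift (fun t => t.eval A.op v) (hc s)) fun o a => by
    change A.op o _ = A.op o _
    congr 1
    funext i
    conv_rhs => rw [← Quotient.out_eq (a i)]
    rfl

theorem present_hom_ext {A : T.Alg} {f g : present G R ⟶ A}
    (h : ∀ s (x : G s), f.map s (Quotient.mk _ (.var x)) = g.map s (Quotient.mk _ (.var x))) :
    f = g := by
  refine Alg.hom_ext fun s x => ?_
  induction x using Quotient.inductionOn with
  | h t =>
    induction t with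
    | var x => exact h _ x
    | app o a ih =>
      have hf := f.map_op o fun i => Quotient.mk (conSetoid G R _) (a i)
      have hg := g.map_op o fun i => Quotient.mk (conSetoid G R _) (a i)
      have e : (present G R).op o (fun i => Quotient.mk (conSetoid G R _) (a i)) = _ :=
        presentOp_mk G R o a
      rw [e] at hf hg
      rw [hf, hg]
      congr 1
      funext i
      exact ih i

end Present

/-- A free algebra on one generator of each sort exists. -/
theorem exists_isFreeOnOneOfEachSort (T : Theory S) :
    ∃ (X : T.Alg) (g : ∀ s, X.carrier s), IsFreeOnOneOfEachSort X g := by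
  refine ⟨present (fun _ => PUnit) fun _ _ _ => False, fun s => Quotient.mk _ (.var ⟨⟩),
    fun Y y => ⟨presentDesc Y (fun s _ => y s) fun _ _ _ h => h.elim, fun _ => rfl, ?_⟩⟩
  intro f hf
  exact present_hom_ext fun s x => hf s

/-- The relations saying that the coproduct injections preserve the operations. -/
inductive CoprodRel {I : Type u} (A : I → T.Alg) :
    ∀ s, T.Term (fun s => Σ i, (A i).carrier s) s → T.Term (fun s => Σ i, (A i).carrier s) s → Prop
  | op (i : I) (o : T.Op) (a : ∀ j, (A i).carrier (T.dom o j)) :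
      CoprodRel A _ (.var ⟨i, (A i).op o a⟩) (.app o fun j => .var ⟨i, a j⟩)

/-- The coproduct of a family of algebras. -/
def coprodAlg {I : Type u} (A : I → T.Alg) : T.Alg :=
  present (fun s => Σ i, (A i).carrier s) (CoprodRel A)

def coprodInj {I : Type u} (A : I → T.Alg) (i : I) : A i ⟶ coprodAlg A :=
  Hom.mk (fun _ x => Quotient.mk (conSetoid _ (CoprodRel A) _) (.var ⟨i, x⟩)) fun o a =>
    (Quotient.sound (s := conSetoid _ (CoprodRel A) _) (.rel (.op i o a))).trans
      (presentOp_mk _ (CoprodRel A) o fun j => .var ⟨i, a j⟩).symm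

def coprodDesc {I : Type u} (A : I → T.Alg) {Z : T.Alg} (f : ∀ i, A i ⟶ Z) : coprodAlg A ⟶ Z :=
  presentDesc Z (fun s x => (f x.1).map s x.2) (by
    rintro _ _ _ ⟨i, o, a⟩
    exact (f i).map_op o a)

def coprodIsColimit {I : Type u} (A : I → T.Alg) :
    IsColimit (Cofan.mk (coprodAlg A) (coprodInj A)) :=
  Cofan.IsColimit.mk _ (fun c => coprodDesc A fun i => c.inj i) (fun _ _ => rfl)
    fun c _ h => present_hom_ext fun s x =>
      congrArg (fun f : A x.1 ⟶ c.pt => Hom.map f s x.2) (h x.1)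

/-- Varieties have all small coproducts. -/
instance : HasCoproducts.{u} T.Alg := fun _ =>
  { has_colimit := fun K =>
      have : HasColimit (Discrete.functor (K.obj ∘ Discrete.mk)) :=
        ⟨⟨⟨_, coprodIsColimit (K.obj ∘ Discrete.mk)⟩⟩⟩
      hasColimit_of_iso Discrete.natIsoFunctor }

instance : HasFiniteCoproducts T.Alg := hasFiniteCoproducts_of_hasCoproducts.{u} _

end Theory

/-! ### The two-valued collapse -/

/-- The objects `X` which are well-supported (the unique map `X ⟶ 1` is epi) or initial. -/
def IsTwoValued (C : Type v) [Category.{u} C] [CartesianMonoidalCategory C] : ObjectProperty C :=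
  fun X => Epi (toUnit X) ∨ Nonempty (IsInitial X)

/-- The two-valued collapse: the full subcategory of well-supported or initial objects. -/
abbrev TwoValuedCollapse (C : Type v) [Category.{u} C] [CartesianMonoidalCategory C] :=
  (IsTwoValued C).FullSubcategory

/-! ### Grothendieck Boolean algebras and `B_J`-sets -/

/-- `P` is a partition of `b`. -/
structure IsPartition {B : Type u} [BooleanAlgebra B] (P : Set B) (b : B) : Prop where
  bot_notMem : ⊥ ∉ P
  isLUB : IsLUB P b
  disjoint : ∀ c ∈ P, ∀ d ∈ P, c ≠ d → c ⊓ d = ⊥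

/-- A zero-dimensional topology on a Boolean algebra. -/
structure ZeroDimTopology (B : Type u) [BooleanAlgebra B] where
  covers : Set (Set B)
  isPartition : ∀ P ∈ covers, IsPartition P ⊤
  finite_mem : ∀ P : Set B, P.Finite → IsPartition P ⊤ → P ∈ covers
  refine_mem : ∀ P ∈ covers, ∀ Q : P → Set B, (∀ b, Q b ∈ covers) →
    {x | ∃ b : P, ∃ c ∈ Q b, x = (b : B) ⊓ c} \ {⊥} ∈ covers
  coarsen_mem : ∀ P ∈ covers, ∀ (I : Type u) (α : P → I), Function.Surjective α →
    ∃ j : I → B, (∀ i, IsLUB {x | ∃ b : P, α b = i ∧ x = (b : B)} (j i)) ∧ Set.range j ∈ covers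

/-- The structure of a `B`-set on `X`; `cond b x y` is written `b(x, y)`. -/
class BSet (B : Type u) [BooleanAlgebra B] (X : Type u) where
  cond : B → X → X → X
  cond_self : ∀ b x, cond b x x = x
  cond_cond_left : ∀ b x y z, cond b (cond b x y) z = cond b x z
  cond_cond_right : ∀ b x y z, cond b x (cond b y z) = cond b x z
  cond_top : ∀ x y, cond ⊤ x y = x
  cond_compl : ∀ b x y, cond bᶜ x y = cond b y x
  cond_inf : ∀ b c x y, cond (b ⊓ c) x y = cond b (cond c x y) y

/-- The additional structure that makes a `B`-set `X` into a `B_J`-set. -/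
class BJSet {B : Type u} [BooleanAlgebra B] (J : ZeroDimTopology B) (X : Type u)
    [BSet B X] where
  glue : ∀ P : Set B, P ∈ J.covers → P.Infinite → (P → X) → X
  glue_const : ∀ (P : Set B) (hP : P ∈ J.covers) (hi : P.Infinite) (x : X),
    glue P hP hi (fun _ => x) = x
  glue_cond : ∀ (P : Set B) (hP : P ∈ J.covers) (hi : P.Infinite) (x y : P → X),
    glue P hP hi (fun b => BSet.cond (b : B) (x b) (y b)) = glue P hP hi x
  cond_glue : ∀ (P : Set B) (hP : P ∈ J.covers) (hi : P.Infinite) (x : P → X) (b : P),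
    BSet.cond (b : B) (glue P hP hi x) (x b) = x b

/-! ### Grothendieck matched pairs and their sets -/

/-- A (non-degenerate) Grothendieck matched pair of algebras on a Boolean algebra `B`
and a monoid `M`; `star m b` is written `m^* b`. -/
structure MatchedPair (B M : Type u) [BooleanAlgebra B] [Monoid M] where
  nondegenerate : (⊥ : B) ≠ ⊤
  J : ZeroDimTopology B
  [bSet : BSet B M]
  [bjSet : BJSet J M]
  star : M → B → B
  one_star : ∀ b, star 1 b = b
  mul_star : ∀ m n b, star (m * n) b = star m (star n b)
  star_top : ∀ m, star m ⊤ = ⊤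
  star_compl : ∀ m b, star m bᶜ = (star m b)ᶜ
  star_inf : ∀ m b c, star m (b ⊓ c) = star m b ⊓ star m c
  star_covers : ∀ m, ∀ P ∈ J.covers, (star m '' P) \ {⊥} ∈ J.covers
  cond_mul : ∀ (b : B) (m n p : M), BSet.cond b m n * p = BSet.cond b (m * p) (n * p)
  mul_cond : ∀ (m : M) (b : B) (n p : M), m * BSet.cond b n p = BSet.cond (star m b) (m * n) (m * p)
  cond_star : ∀ (b : B) (m n : M) (c : B), star (BSet.cond b m n) c = (b ⊓ star m c) ⊔ (bᶜ ⊓ star n c)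

namespace MatchedPair

variable {B M : Type u} [BooleanAlgebra B] [Monoid M]

/-- The action of `B` on `M`. -/
abbrev mcond (P : MatchedPair B M) (b : B) (m n : M) : M := P.bSet.cond b m n

/-- The `⟨B_J | M⟩`-sets of a matched pair `P = ⟨B_J | M⟩`. -/
structure SetOver (P : MatchedPair B M) where
  carrier : Type u
  [bSet : BSet B carrier]
  [bjSet : BJSet P.J carrier]
  [action : MulAction M carrier]
  cond_smul : ∀ (b : B) (m n : M) (x : carrier),
    P.mcond b m n • x = BSet.cond b (m • x) (n • x)
  smul_cond : ∀ (m : M) (b : B) (x y : carrier),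
    m • BSet.cond b x y = BSet.cond (P.star m b) (m • x) (m • y)

attribute [instance] SetOver.bSet SetOver.bjSet SetOver.action

variable {P : MatchedPair B M}

/-- Homomorphisms of `⟨B_J | M⟩`-sets. -/
@[ext]
structure SetHom (X Y : P.SetOver) where
  map : X.carrier → Y.carrier
  map_cond : ∀ (b : B) x y, map (BSet.cond b x y) = BSet.cond b (map x) (map y)
  map_glue : ∀ (Q : Set B) (hQ : Q ∈ P.J.covers) (hi : Q.Infinite) (x : Q → X.carrier),
    map (BJSet.glue Q hQ hi x) = BJSet.glue Q hQ hi fun b => map (x b)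
  map_smul : ∀ (m : M) x, map (m • x) = m • map x

/-- The category of `⟨B_J | M⟩`-sets. -/
instance : Category.{u} P.SetOver where
  Hom := SetHom
  id X := ⟨fun x => x, fun _ _ _ => rfl, fun _ _ _ _ => rfl, fun _ _ => rfl⟩
  comp f g := ⟨fun x => g.map (f.map x),
    fun b x y => by rw [f.map_cond, g.map_cond],
    fun Q hQ hi x => by rw [f.map_glue, g.map_glue],
    fun m x => by rw [f.map_smul, g.map_smul]⟩

end MatchedPair

/-! ### The matched pair determined by an object of a cartesian closed category -/

section OfObject

variable {C : Type v} [Category.{u} C] [CartesianMonoidalCategory C]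

/-- The monoid `C(X, X)`. -/
def EndMonoid (X : C) : Type u := X ⟶ X

/-- The product is composition in diagrammatic order: `m * n` is `m` followed by `n`. -/
instance (X : C) : Monoid (EndMonoid X) where
  one := 𝟙 X
  mul m n := (show X ⟶ X from m) ≫ (show X ⟶ X from n)
  one_mul m := Category.id_comp (show X ⟶ X from m)
  mul_one m := Category.comp_id (show X ⟶ X from m)
  mul_assoc m n p := Category.assoc (show X ⟶ X from m) (show X ⟶ X from n) (show X ⟶ X from p)

variable [HasBinaryCoproducts C]

variable (C) in
/-- The coproduct `1 + 1`. -/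
abbrev Two : C := 𝟙_ C ⨿ 𝟙_ C

variable (C) in
/-- The coproduct injection `ι_⊤`. -/
abbrev iTop : 𝟙_ C ⟶ Two C := coprod.inl

variable (C) in
/-- The coproduct injection `ι_⊥`. -/
abbrev iBot : 𝟙_ C ⟶ Two C := coprod.inr

/-- The set `C(X, 1 + 1)`. -/
def Decision (X : C) : Type u := X ⟶ Two C

namespace Decision

variable {X : C}

def toHom (b : Decision X) : X ⟶ Two C := b

def top : Decision X := toUnit X ≫ iTop C

def bot : Decision X := toUnit X ≫ iBot C

def compl (b : Decision X) : Decision X := b.toHom ≫ coprod.desc (iBot C) (iTop C)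

/-- The action of `C(X, X)` on `C(X, 1 + 1)` by precomposition. -/
def precomp (m : EndMonoid X) (b : Decision X) : Decision X := (show X ⟶ X from m) ≫ b.toHom

variable [MonoidalClosed C]

variable (C) in
/-- The map `∧ : (1 + 1) × (1 + 1) ⟶ 1 + 1`: under `(1 + 1) × (1 + 1) ≅ (1 + 1) × 1 + (1 + 1) × 1`
it is the projection on the first summand and is constant at `ι_⊥` on the second one. -/
def andMap : Two C ⊗ Two C ⟶ Two C :=
  (leftDistrib (Two C) (𝟙_ C) (𝟙_ C)).inv ≫ coprod.desc (fst _ _) (toUnit _ ≫ iBot C)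

def inf (b c : Decision X) : Decision X := lift b.toHom c.toHom ≫ andMap C

/-- `b(x, y)` is the composite `X ⟶ X × (1 + 1) ≅ X + X ⟶ Y` of `(id, b)`, the distributivity
isomorphism, and the copairing of `x` and `y`. -/
def ifThenElse {Y : C} (b : Decision X) (x y : X ⟶ Y) : X ⟶ Y :=
  lift (𝟙 X) b.toHom ≫ (leftDistrib X (𝟙_ C) (𝟙_ C)).inv ≫
    coprod.desc (fst _ _ ≫ x) (fst _ _ ≫ y)

end Decision

open Classical in
/-- The covers of the topology on `C(X, 1 + 1)`: the sets `P` of non-zero elements for which there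
is a map `f` from `X` to the copower `P · 1` whose composite with `⟨δ_{bc}⟩_{b ∈ P}` is `c` for
each `c ∈ P`, where `δ_{bc}` is `ι_⊤` if `b = c` and `ι_⊥` otherwise. -/
def Decision.IsCover [HasCoproducts.{u} C] {X : C} (P : Set (Decision X)) : Prop :=
  Decision.bot ∉ P ∧
    ∃ f : X ⟶ ∐ (fun _ : P => 𝟙_ C), ∀ c : P,
      f ≫ Sigma.desc (fun b : P => if b = c then iTop C else iBot C) = (c : Decision X).toHom

/-- The matched pair `P` is the one defined from the object `X`. (The operations of infinite arity
on the monoid are not mentioned since they are determined by the binary operations.) -/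
structure MatchedPair.IsDefinedFrom [HasCoproducts.{u} C] [MonoidalClosed C] (X : C)
    [BooleanAlgebra (Decision X)] (P : MatchedPair (Decision X) (EndMonoid X)) : Prop where
  top_eq : (⊤ : Decision X) = Decision.top
  compl_eq : ∀ b : Decision X, bᶜ = Decision.compl b
  inf_eq : ∀ b c : Decision X, b ⊓ c = Decision.inf b c
  mem_covers : ∀ Q : Set (Decision X), Q ∈ P.J.covers ↔ Decision.IsCover Q
  star_eq : ∀ (m : EndMonoid X) (b : Decision X), P.star m b = Decision.precomp m b
  cond_eq : ∀ (b : Decision X) (m n : EndMonoid X),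
    P.mcond b m n = Decision.ifThenElse (Y := X) b m n

end OfObject

end

/-!
The idea is to recover everything from the maps from `X` into copowers. In a cartesian closed
category the copower `∐_I 1` is stable under products, so that a map `h : X ⟶ ∐_I 1` allows the
definition of morphisms `X ⟶ Y` by cases (`IsCopower.case`, `Decision.select`). Cases along
`1 + 1` make `C(X, 1 + 1)` a Boolean algebra `B` and every `C(X, Y)` a `B`-set. The components of
a map `X ⟶ ∐_I 1` form a partition of `B` once zeros are dropped (`Decision.isCover_range`), and
this gives the axioms of a zero-dimensional topology and of a matched pair
(`Decision.topology`, `Decision.matchedPair`). Thus `Y ↦ C(X, Y)` is a functor from the category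
to the sets over the matched pair of `X`.

Elements of a `B_J`-set are determined by, and can be glued from, their restrictions to the members
of a cover (`BJSet.eq_of_agree`, `BJSet.exists_agree`). Since `∐_I X ≅ X × ∐_I 1`, every map
`X ⟶ ∐_I X` consists of an endomorphism of `X` and a map into `∐_I 1`; it follows that
`C(X, ∐_I X)` is the free set over the matched pair on `I` generators
(`Decision.copower_hom_ext`, `Decision.exists_copower_hom`).

Now let `X` be the free algebra on one generator of each sort of a variety that is a topos. Since a
topos is balanced, the objects of the two-valued collapse are the initial ones and the algebras with
all sorts inhabited. An algebra `Y` of the latter kind is a quotient of a copower of `X`, and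
homomorphisms out of `C(X, Y)` come from homomorphisms out of `Y` by freeness of the copowers.
Conversely, an inhabited set `W` over the matched pair is `C(X, Y)` for the quotient `Y` of
`∐_W X` in which two elements of sort `s` are identified when they induce the same element of `W`;
the decisions "the sort is `s`" show that the kernel of `C(X, ∐_W X) ⟶ W` is determined sort by
sort (`Theory.IsFreeOnOneOfEachSort.exists_homSet_iso`). The empty set corresponds to the initial
algebras. Hence `Y ↦ C(X, Y)` is an equivalence from the two-valued collapse to the sets over the
matched pair.

These sets form a single-sorted variety (`MatchedPair.setTheory`) in which `C(X, X)` is free on the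
identity. It is cartesian closed because the two-valued collapse is closed under finite products
and exponentials.
-/

noncomputable section

/-! ### Sets over a Boolean algebra as sheaves -/

namespace BSet

variable {B : Type u} [BooleanAlgebra B] {W : Type u} [BSet B W]

/-- The elements `x` and `y` have the same restriction to `b`. -/
def Agree (b : B) (x y : W) : Prop := cond b x y = y

theorem agree_iff {b : B} {x y : W} : Agree b x y ↔ ∀ z, cond b x z = cond b y z := by
  constructor
  · intro h z
    rw [← (show cond b x y = y from h), cond_cond_left]
  · intro h
    exact (h y).trans (cond_self b y)

theorem agree_of_cond_eq {b : B} {x y z : W} (h : cond b x z = cond b y z) : Agree b x y :=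
  agree_iff.2 fun w => by rw [← cond_cond_left b x z w, h, cond_cond_left]

theorem Agree.symm {b : B} {x y : W} (h : Agree b x y) : Agree b y x :=
  agree_iff.2 fun z => (agree_iff.1 h z).symm

theorem Agree.trans {b : B} {x y z : W} (h : Agree b x y) (h' : Agree b y z) : Agree b x z :=
  agree_iff.2 fun w => (agree_iff.1 h w).trans (agree_iff.1 h' w)

theorem agree_cond (b : B) (x y : W) : Agree b (cond b x y) x :=
  agree_iff.2 fun z => cond_cond_left b x y z

theorem cond_bot (x y : W) : cond (⊥ : B) x y = y := by
  rw [← compl_top, cond_compl, cond_top]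

theorem agree_bot (x y : W) : Agree (⊥ : B) x y := cond_bot x y

theorem agree_top {x y : W} : Agree (⊤ : B) x y ↔ x = y := by
  unfold Agree
  rw [cond_top]

theorem cond_sup (b c : B) (x y : W) : cond (b ⊔ c) x y = cond b x (cond c x y) := by
  rw [← compl_compl (b ⊔ c), compl_sup, cond_compl, cond_inf, cond_compl, cond_compl]

theorem Agree.sup {b c : B} {x y : W} (h : Agree b x y) (h' : Agree c x y) :
    Agree (b ⊔ c) x y := by
  unfold Agree
  rw [cond_sup, show cond c x y = y from h', show cond b x y = y from h]

theorem Agree.mono {b c : B} {x y : W} (h : Agree c x y) (hbc : b ≤ c) : Agree b x y := by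
  unfold Agree
  rw [← inf_eq_left.2 hbc, cond_inf, show cond c x y = y from h, cond_self]

theorem agree_compl_cond (b : B) (x y : W) : Agree bᶜ (BSet.cond b x y) y := by
  rw [← cond_compl]
  exact agree_cond _ _ _

theorem Agree.cond_cond {b c d : B} {x x' y y' : W} (h : Agree c x y) (h' : Agree d x' y') :
    Agree ((b ⊓ c) ⊔ (bᶜ ⊓ d)) (BSet.cond b x x') (BSet.cond b y y') := by
  refine Agree.sup ?_ ?_
  · exact ((agree_cond b x x').mono inf_le_left).trans
      ((h.mono inf_le_right).trans ((agree_cond b y y').symm.mono inf_le_left))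
  · exact ((agree_compl_cond b x x').mono inf_le_left).trans
      ((h'.mono inf_le_right).trans ((agree_compl_cond b y y').symm.mono inf_le_left))

/-- Elements can be glued along finitely many pairwise disjoint members of `B`. -/
theorem exists_agree_of_finset (Q : Finset B) (hQ : ∀ c ∈ Q, ∀ d ∈ Q, c ≠ d → c ⊓ d = ⊥)
    (y : B → W) : ∃ t : W, ∀ c ∈ Q, Agree c t (y c) := by
  classical
  induction Q using Finset.induction_on with
  | empty => exact ⟨y ⊥, by simp⟩
  | insert q Q hq ih =>
    obtain ⟨t, ht⟩ := ih fun c hc d hd =>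
      hQ c (Finset.mem_insert_of_mem hc) d (Finset.mem_insert_of_mem hd)
    refine ⟨BSet.cond q (y q) t, fun c hc => ?_⟩
    obtain rfl | hc := Finset.mem_insert.1 hc
    · exact agree_cond _ _ _
    · have hd : c ≤ qᶜ := by
        rw [le_compl_iff_disjoint_right, disjoint_iff]
        exact hQ c (Finset.mem_insert_of_mem hc) q (Finset.mem_insert_self _ _) fun e =>
          hq (e ▸ hc)
      exact ((agree_compl_cond _ _ _).mono hd).trans (ht c hc)

end BSet

namespace BJSet

open BSet

variable {B : Type u} [BooleanAlgebra B] {J : ZeroDimTopology B} {W : Type u} [BSet B W]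
  [BJSet J W] {P : Set B}

variable (J) in
/-- Elements are determined by their restrictions to the members of a cover. -/
theorem eq_of_agree (hP : P ∈ J.covers) {x y : W} (h : ∀ p ∈ P, Agree p x y) : x = y := by
  by_cases hi : P.Infinite
  · rw [← glue_const P hP hi x, ← glue_cond P hP hi (fun _ => x) fun _ => y,
      ← glue_const P hP hi y]
    congr 1
    funext p
    rw [glue_const]
    exact h p p.2
  · have hf := Set.not_infinite.1 hi
    rw [← agree_top (B := B)]
    have hs : Agree (hf.toFinset.sup id) x y :=
      Finset.sup_induction (p := fun b => Agree b x y) (agree_bot x y)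
        (fun _ h _ h' => h.sup h') fun p hp => h p (hf.mem_toFinset.1 hp)
    refine hs.mono ((J.isPartition P hP).isLUB.2 fun p hp => ?_)
    exact Finset.le_sup (f := id) (hf.mem_toFinset.2 hp)

variable (J) in
/-- Elements can be glued along a cover. -/
theorem exists_agree (hP : P ∈ J.covers) (y : B → W) : ∃ t : W, ∀ p ∈ P, Agree p t (y p) := by
  by_cases hi : P.Infinite
  · exact ⟨glue P hP hi fun p => y p, fun p hp => cond_glue P hP hi (fun p => y p) ⟨p, hp⟩⟩
  · have hf := Set.not_infinite.1 hi
    have hd := (J.isPartition P hP).disjoint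
    obtain ⟨t, ht⟩ := exists_agree_of_finset hf.toFinset (fun c hc d hd' =>
      hd c (hf.mem_toFinset.1 hc) d (hf.mem_toFinset.1 hd')) y
    exact ⟨t, fun p hp => ht p (hf.mem_toFinset.2 hp)⟩

end BJSet

namespace MatchedPair

open BSet

variable {B M : Type u} [BooleanAlgebra B] [Monoid M] {P : MatchedPair B M}

/-- The infinitary operations are determined by the binary ones, so that a map preserving the
binary ones and the monoid action is a homomorphism. -/
def homOfCond {V W : P.SetOver} (f : V.carrier → W.carrier)
    (h : ∀ (b : B) x y, f (cond b x y) = cond b (f x) (f y))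
    (h' : ∀ (m : M) x, f (m • x) = m • f x) : V ⟶ W :=
  SetHom.mk f h
    (fun Q hQ hi x => BJSet.eq_of_agree P.J hQ fun p hp => by
      have h₁ : Agree p (f (BJSet.glue Q hQ hi x)) (f (x ⟨p, hp⟩)) := by
        unfold Agree
        rw [← h, BJSet.cond_glue Q hQ hi x ⟨p, hp⟩]
      have h₂ : Agree p (BJSet.glue Q hQ hi fun b => f (x b)) (f (x ⟨p, hp⟩)) :=
        BJSet.cond_glue Q hQ hi (fun b => f (x b)) ⟨p, hp⟩
      exact h₁.trans h₂.symm) h'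

theorem setHom_ext {V W : P.SetOver} {f g : V ⟶ W} (h : ∀ x, SetHom.map f x = SetHom.map g x) :
    f = g :=
  SetHom.ext (funext h)

theorem isIso_of_bijective {V W : P.SetOver} (f : V ⟶ W)
    (h : Function.Bijective (SetHom.map f)) : IsIso f := by
  let e := Equiv.ofBijective _ h
  have he : ∀ x, SetHom.map f (e.symm x) = x := e.apply_symm_apply
  refine ⟨homOfCond e.symm (fun b x y => h.1 ?_) (fun m x => h.1 ?_), ?_, ?_⟩
  · rw [f.map_cond, he, he, he]
  · rw [f.map_smul, he, he]
  · exact setHom_ext fun x => e.symm_apply_apply x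
  · exact setHom_ext fun x => he x

/-- Two surjective homomorphisms with the same kernel have isomorphic codomains. -/
theorem nonempty_iso_of_surjective {U V W : P.SetOver} (f : U ⟶ V) (g : U ⟶ W)
    (hf : Function.Surjective (SetHom.map f)) (hg : Function.Surjective (SetHom.map g))
    (h : ∀ x y, SetHom.map f x = SetHom.map f y ↔ SetHom.map g x = SetHom.map g y) :
    Nonempty (V ≅ W) := by
  let s := Function.surjInv hf
  have hs : ∀ x, SetHom.map f (s x) = x := Function.surjInv_eq hf
  have hk : ∀ x, SetHom.map g (s (SetHom.map f x)) = SetHom.map g x := fun x =>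
    (h _ _).1 (hs _)
  let k : V ⟶ W := homOfCond (fun x => SetHom.map g (s x))
    (fun b x y => by
      rw [← g.map_cond]
      refine (h _ _).1 ?_
      rw [f.map_cond, hs, hs, hs])
    (fun m x => by
      rw [← g.map_smul]
      refine (h _ _).1 ?_
      rw [f.map_smul, hs, hs])
  have : IsIso k := isIso_of_bijective k ⟨fun x y e => by
      rw [← hs x, ← hs y]
      exact (h _ _).2 e, fun z => by
      obtain ⟨x, rfl⟩ := hg z
      exact ⟨SetHom.map f x, hk x⟩⟩
  exact ⟨asIso k⟩

end MatchedPair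

/-! ### Case distinction along copowers of the terminal object -/

section Copower

variable {C : Type v} [Category.{u} C] [CartesianMonoidalCategory C]

/-- The points `ι i` of `K` make `K` the copower of the terminal object by `I`, stably under
products: morphisms out of `Z ⊗ K` are the same as families of morphisms out of `Z`. -/
structure IsCopower {I : Type w} {K : C} (ι : I → (𝟙_ C ⟶ K)) : Prop where
  existsUnique : ∀ {Z Y : C} (y : I → (Z ⟶ Y)),
    ∃! t : Z ⊗ K ⟶ Y, ∀ i, lift (𝟙 Z) (toUnit Z ≫ ι i) ≫ t = y i

/-- In a cartesian closed category every copower of the terminal object is stable under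
products. -/
theorem IsCopower.of_closed [MonoidalClosed C] {I : Type w} {K : C} {ι : I → (𝟙_ C ⟶ K)}
    (h : ∀ {Y : C} (y : I → (𝟙_ C ⟶ Y)), ∃! t : K ⟶ Y, ∀ i, ι i ≫ t = y i) :
    IsCopower ι where
  existsUnique {Z Y} y := by
    have key : ∀ (t : Z ⊗ K ⟶ Y) i, lift (𝟙 Z) (toUnit Z ≫ ι i) ≫ t = y i ↔
        ι i ≫ MonoidalClosed.curry t = MonoidalClosed.curry (fst _ _ ≫ y i) := by
      intro t i
      rw [← MonoidalClosed.curry_natural_left, (MonoidalClosed.curry_injective).eq_iff]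
      have e : Z ◁ ι i = fst _ _ ≫ lift (𝟙 Z) (toUnit Z ≫ ι i) := by
        ext <;> simp
        exact congrArg (· ≫ ι i) (toUnit_unique _ _)
      rw [e, Category.assoc]
      constructor
      · intro h
        rw [h]
      · intro h
        simpa using congrArg (fun f => lift (𝟙 Z) (toUnit Z) ≫ f) h
    obtain ⟨t, ht, hu⟩ := h fun i => MonoidalClosed.curry (fst _ _ ≫ y i)
    refine ⟨MonoidalClosed.uncurry t, fun i => ?_, fun t' ht' => ?_⟩
    · rw [key, MonoidalClosed.curry_uncurry]
      exact ht i
    · rw [← MonoidalClosed.curry_eq_iff]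
      exact hu _ fun i => (key t' i).1 (ht' i)

theorem isCopower_sigma [MonoidalClosed C] [HasCoproducts.{u} C] (I : Type u) :
    IsCopower (fun i : I => Sigma.ι (fun _ : I => 𝟙_ C) i) :=
  .of_closed fun y => ⟨Sigma.desc y, fun i => by simp, fun t ht => by
    refine Sigma.hom_ext _ _ fun i => ?_
    simpa using ht i⟩

variable (C) in
/-- The two points of `1 + 1`, indexed by the Booleans. -/
def twoPoint [HasBinaryCoproducts C] : Bool → (𝟙_ C ⟶ Two C)
  | true => iTop C
  | false => iBot C

variable (C) in
theorem isCopower_two [MonoidalClosed C] [HasBinaryCoproducts C] : IsCopower (twoPoint C) :=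
  .of_closed fun y => ⟨coprod.desc (y true) (y false), fun i => by
      cases i
      · exact coprod.inr_desc _ _
      · exact coprod.inl_desc _ _,
    fun t ht => coprod.hom_ext ((ht true).trans (coprod.inl_desc _ _).symm)
      ((ht false).trans (coprod.inr_desc _ _).symm)⟩

namespace IsCopower

variable {I : Type w} {K : C} {ι : I → (𝟙_ C ⟶ K)}

theorem hom_ext (hK : IsCopower ι) {Z Y : C} {t t' : Z ⊗ K ⟶ Y}
    (h : ∀ i, lift (𝟙 Z) (toUnit Z ≫ ι i) ≫ t = lift (𝟙 Z) (toUnit Z ≫ ι i) ≫ t') : t = t' :=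
  (hK.existsUnique fun i => lift (𝟙 Z) (toUnit Z ≫ ι i) ≫ t').unique h fun _ => rfl

/-- The morphism out of `Z ⊗ K` induced by a family of morphisms out of `Z`. -/
def desc (hK : IsCopower ι) {Z Y : C} (y : I → (Z ⟶ Y)) : Z ⊗ K ⟶ Y :=
  (hK.existsUnique y).exists.choose

theorem fac (hK : IsCopower ι) {Z Y : C} (y : I → (Z ⟶ Y)) (i : I) :
    lift (𝟙 Z) (toUnit Z ≫ ι i) ≫ hK.desc y = y i :=
  (hK.existsUnique y).exists.choose_spec i

/-- The morphism that is `y i` where the "`I`-valued function" `h` takes the value `i`. -/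
def case (hK : IsCopower ι) {Z Y : C} (h : Z ⟶ K) (y : I → (Z ⟶ Y)) : Z ⟶ Y :=
  lift (𝟙 Z) h ≫ hK.desc y

variable (hK : IsCopower ι) {Z Y : C}

theorem desc_uniq (y : I → (Z ⟶ Y)) {t : Z ⊗ K ⟶ Y}
    (h : ∀ i, lift (𝟙 Z) (toUnit Z ≫ ι i) ≫ t = y i) : hK.desc y = t :=
  hK.hom_ext fun i => (hK.fac y i).trans (h i).symm

theorem case_comp (h : Z ⟶ K) (y : I → (Z ⟶ Y)) {Y' : C} (f : Y ⟶ Y') :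
    hK.case h y ≫ f = hK.case h fun i => y i ≫ f := by
  unfold case
  rw [Category.assoc]
  congr 1
  refine (hK.desc_uniq _ fun i => ?_).symm
  rw [← Category.assoc, hK.fac]

theorem lift_desc {Z' : C} (m : Z' ⟶ Z) (h : Z' ⟶ K) (y : I → (Z ⟶ Y)) :
    lift m h ≫ hK.desc y = hK.case h fun i => m ≫ y i := by
  unfold case
  have e : hK.desc (fun i => m ≫ y i) = (m ▷ K) ≫ hK.desc y := by
    refine hK.desc_uniq _ fun i => ?_
    have : lift (𝟙 Z') (toUnit Z' ≫ ι i) ≫ m ▷ K = m ≫ lift (𝟙 Z) (toUnit Z ≫ ι i) := by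
      ext <;> simp
    rw [← Category.assoc, this, Category.assoc, hK.fac]
  rw [e, lift_whiskerRight_assoc, Category.id_comp]

theorem comp_case {Z' : C} (m : Z' ⟶ Z) (h : Z ⟶ K) (y : I → (Z ⟶ Y)) :
    m ≫ hK.case h y = hK.case (m ≫ h) fun i => m ≫ y i := by
  rw [← lift_desc, case, ← Category.assoc, comp_lift, Category.comp_id]

@[simp]
theorem case_point (i : I) (y : I → (Z ⟶ Y)) : hK.case (toUnit Z ≫ ι i) y = y i :=
  hK.fac y i

@[simp]
theorem case_const (h : Z ⟶ K) (y : Z ⟶ Y) : hK.case h (fun _ => y) = y := by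
  unfold case
  rw [hK.desc_uniq (t := fst _ _ ≫ y) _ fun i => by simp]
  simp

@[simp]
theorem case_eta (h : Z ⟶ K) : hK.case h (fun i => toUnit Z ≫ ι i) = h := by
  unfold case
  rw [hK.desc_uniq (t := snd _ _) _ fun i => by simp]
  simp

/-- In the branch `i` of a case distinction along `h`, the morphism `h` may be replaced by the
constant `i`. -/
theorem case_subst (h : Z ⟶ K) (G : I → (Z ⊗ K ⟶ Y)) :
    hK.case h (fun i => lift (𝟙 Z) h ≫ G i) =
      hK.case h fun i => lift (𝟙 Z) (toUnit Z ≫ ι i) ≫ G i := by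
  have key : hK.case (snd Z K) G =
      hK.case (snd Z K) fun i => fst Z K ≫ lift (𝟙 Z) (toUnit Z ≫ ι i) ≫ G i := by
    refine hK.hom_ext fun j => ?_
    rw [comp_case, comp_case]
    simp only [lift_snd, lift_fst_assoc, Category.id_comp, case_point]
  have := congrArg (fun t => lift (𝟙 Z) h ≫ t) key
  rw [comp_case, comp_case] at this
  simpa only [lift_snd, lift_fst_assoc, Category.id_comp] using this

theorem case_case_self (h : Z ⟶ K) (y : I → I → (Z ⟶ Y)) :
    hK.case h (fun i => hK.case h (y i)) = hK.case h fun i => y i i := by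
  unfold case
  refine (hK.case_subst h fun i => hK.desc (y i)).trans ?_
  simp only [hK.fac]
  rfl

variable {I' : Type*} {K' : C} {ι' : I' → (𝟙_ C ⟶ K')} (hK' : IsCopower ι')

theorem lift_case {Y' : C} (h : Z ⟶ K) (y : I → (Z ⟶ Y)) (y' : I → (Z ⟶ Y')) :
    lift (hK.case h y) (hK.case h y') = hK.case h fun i => lift (y i) (y' i) := by
  ext
  · rw [case_comp]; simp
  · rw [case_comp]; simp

theorem case_case (h : Z ⟶ K) (k : I → (Z ⟶ K')) (y : I' → (Z ⟶ Y)) :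
    hK'.case (hK.case h k) y = hK.case h fun i => hK'.case (k i) y := by
  unfold case
  change lift (𝟙 Z) (hK.case h k) ≫ _ = hK.case h fun i => _
  rw [← hK.case_comp]
  congr 1
  rw [← hK.lift_case, hK.case_const]

theorem case_comm (h : Z ⟶ K) (k : Z ⟶ K') (y : I → I' → (Z ⟶ Y)) :
    hK.case h (fun i => hK'.case k (y i)) = hK'.case k fun j => hK.case h fun i => y i j := by
  have key : hK.case (fst Z K' ≫ h) (fun i => hK'.case (snd Z K') fun j => fst Z K' ≫ y i j) =
      hK'.case (snd Z K') fun j => hK.case (fst Z K' ≫ h) fun i => fst Z K' ≫ y i j := by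
    refine hK'.hom_ext fun j => ?_
    simp only [comp_case, lift_snd, lift_fst_assoc, Category.id_comp, case_point]
  simpa only [comp_case, lift_snd, lift_fst_assoc, Category.id_comp] using
    congrArg (fun t => lift (𝟙 Z) k ≫ t) key

/-- A test on `h` in a branch of a case distinction along `h` is decided by that branch. -/
theorem case_case_test (h : Z ⟶ K) (δ : I → (K ⟶ K')) (y : I → I' → (Z ⟶ Y)) :
    hK.case h (fun i => hK'.case (h ≫ δ i) (y i)) =
      hK.case h fun i => hK'.case (toUnit Z ≫ ι i ≫ δ i) (y i) := by
  have := hK.case_subst h fun i => (Z ◁ δ i) ≫ hK'.desc (y i)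
  have e : ∀ (k : Z ⟶ K) i, lift (𝟙 Z) k ≫ (Z ◁ δ i) ≫ hK'.desc (y i) =
      hK'.case (k ≫ δ i) (y i) := by
    intro k i
    unfold case
    rw [← Category.assoc]
    congr 1
    ext <;> simp
  simpa only [e, Category.assoc] using this

end IsCopower

end Copower

/-! ### The Boolean algebra of decisions -/

namespace Decision

variable {C : Type v} [Category.{u} C] [CartesianMonoidalCategory C] [HasBinaryCoproducts C]
  {X Y : C}

theorem precomp_top (m : EndMonoid X) : precomp m top = top := by
  change _ ≫ toUnit X ≫ iTop C = toUnit X ≫ iTop C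
  rw [comp_toUnit_assoc]

variable [MonoidalClosed C]

variable (X) in
theorem lift_iTop_leftDistrib_inv :
    lift (𝟙 X) (toUnit X ≫ iTop C) ≫ (leftDistrib X (𝟙_ C) (𝟙_ C)).inv =
      lift (𝟙 X) (toUnit X) ≫ coprod.inl := by
  rw [← whiskerLeft_coprod_inl_leftDistrib_inv, lift_whiskerLeft_assoc]

variable (X) in
theorem lift_iBot_leftDistrib_inv :
    lift (𝟙 X) (toUnit X ≫ iBot C) ≫ (leftDistrib X (𝟙_ C) (𝟙_ C)).inv =
      lift (𝟙 X) (toUnit X) ≫ coprod.inr := by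
  rw [← whiskerLeft_coprod_inr_leftDistrib_inv, lift_whiskerLeft_assoc]

theorem ifThenElse_eq_case (b : Decision X) (x y : X ⟶ Y) :
    ifThenElse b x y = (isCopower_two C).case b.toHom fun i => bif i then x else y := by
  unfold ifThenElse IsCopower.case
  congr 1
  refine ((isCopower_two C).desc_uniq _ fun i => ?_).symm
  cases i
  · refine (reassoc_of% (lift_iBot_leftDistrib_inv X)) _ |>.trans ?_
    rw [coprod.inr_desc, lift_fst_assoc, Category.id_comp]
    rfl
  · refine (reassoc_of% (lift_iTop_leftDistrib_inv X)) _ |>.trans ?_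
    rw [coprod.inl_desc, lift_fst_assoc, Category.id_comp]
    rfl

theorem inf_eq_ifThenElse (b c : Decision X) : inf b c = ifThenElse c b.toHom bot.toHom := by
  have key : andMap C = (isCopower_two C).desc
      fun i => bif i then 𝟙 _ else toUnit _ ≫ iBot C := by
    refine ((isCopower_two C).desc_uniq _ fun i => ?_).symm
    unfold andMap
    cases i
    · refine (reassoc_of% (lift_iBot_leftDistrib_inv (Two C))) _ |>.trans ?_
      rw [coprod.inr_desc, ← Category.assoc]
      exact congrArg (· ≫ iBot C) (toUnit_unique _ _)
    · refine (reassoc_of% (lift_iTop_leftDistrib_inv (Two C))) _ |>.trans ?_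
      rw [coprod.inl_desc, lift_fst]
      rfl
  unfold inf
  rw [ifThenElse_eq_case, key, IsCopower.lift_desc]
  congr 1
  funext i
  cases i
  · change b.toHom ≫ toUnit _ ≫ iBot C = toUnit _ ≫ iBot C
    rw [comp_toUnit_assoc]
  · exact Category.comp_id _

theorem ifThenElse_comp {Z : C} (b : Decision X) (x y : X ⟶ Y) (f : Y ⟶ Z) :
    ifThenElse b x y ≫ f = ifThenElse b (x ≫ f) (y ≫ f) := by
  simp only [ifThenElse_eq_case, IsCopower.case_comp]
  congr 1; funext i; cases i <;> rfl

theorem comp_ifThenElse {b : Decision X} (m : X ⟶ X) (x y : X ⟶ Y) :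
    m ≫ ifThenElse b x y = ifThenElse (precomp m b) (m ≫ x) (m ≫ y) := by
  simp only [ifThenElse_eq_case, IsCopower.comp_case]
  congr 1; funext i; cases i <;> rfl

@[simp]
theorem ifThenElse_self (b : Decision X) (x : X ⟶ Y) : ifThenElse b x x = x := by
  rw [ifThenElse_eq_case]
  simp only [Bool.cond_self, IsCopower.case_const]

@[simp]
theorem ifThenElse_top (x y : X ⟶ Y) : ifThenElse top x y = x := by
  rw [ifThenElse_eq_case]
  exact (isCopower_two C).case_point true _

@[simp]
theorem ifThenElse_bot (x y : X ⟶ Y) : ifThenElse bot x y = y := by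
  rw [ifThenElse_eq_case]
  exact (isCopower_two C).case_point false _

@[simp]
theorem ifThenElse_left (b : Decision X) (x y z : X ⟶ Y) :
    ifThenElse b (ifThenElse b x y) z = ifThenElse b x z := by
  simp only [ifThenElse_eq_case]
  have := (isCopower_two C).case_case_self b.toHom
    fun i j => bif i then (bif j then x else y) else z
  convert this using 2
  · funext i; cases i <;> simp
  · funext i; cases i <;> simp

@[simp]
theorem ifThenElse_right (b : Decision X) (x y z : X ⟶ Y) :
    ifThenElse b x (ifThenElse b y z) = ifThenElse b x z := by
  simp only [ifThenElse_eq_case]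
  have := (isCopower_two C).case_case_self b.toHom
    fun i j => bif i then x else (bif j then y else z)
  convert this using 2
  · funext i; cases i <;> simp
  · funext i; cases i <;> simp

theorem ifThenElse_comm (b c : Decision X) (x y z w : X ⟶ Y) :
    ifThenElse b (ifThenElse c x y) (ifThenElse c z w) =
      ifThenElse c (ifThenElse b x z) (ifThenElse b y w) := by
  simp only [ifThenElse_eq_case]
  have := (isCopower_two C).case_comm (isCopower_two C) b.toHom c.toHom
    fun i j => bif i then (bif j then x else y) else (bif j then z else w)
  convert this using 2
  · funext i; cases i <;> simp
  · funext i; cases i <;> simp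

/-- The decision that takes the value of `c` where `b` holds and that of `d` elsewhere. -/
def ite (b c d : Decision X) : Decision X := ifThenElse b c.toHom d.toHom

@[simp]
theorem ifThenElse_ite (b c d : Decision X) (x y : X ⟶ Y) :
    ifThenElse (ite b c d) x y = ifThenElse b (ifThenElse c x y) (ifThenElse d x y) := by
  have h : (ite b c d).toHom = (isCopower_two C).case b.toHom fun i =>
      bif i then c.toHom else d.toHom := ifThenElse_eq_case b c.toHom d.toHom
  rw [ifThenElse_eq_case (ite b c d), h, IsCopower.case_case, ifThenElse_eq_case b]
  congr 1
  funext i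
  cases i <;> exact (ifThenElse_eq_case _ _ _).symm

@[simp]
theorem ite_top_bot (b : Decision X) : ite b top bot = b := by
  unfold ite
  rw [ifThenElse_eq_case]
  refine Eq.trans ?_ ((isCopower_two C).case_eta b.toHom)
  congr 1; funext i; cases i <;> rfl

theorem ite_ite (b c d x y : Decision X) : ite (ite b c d) x y = ite b (ite c x y) (ite d x y) :=
  ifThenElse_ite _ _ _ _ _

@[simp] theorem ite_self (b x : Decision X) : ite b x x = x := ifThenElse_self _ _
@[simp] theorem top_ite (x y : Decision X) : ite top x y = x := ifThenElse_top _ _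
@[simp] theorem bot_ite (x y : Decision X) : ite bot x y = y := ifThenElse_bot _ _

@[simp] theorem ite_left (b x y z : Decision X) : ite b (ite b x y) z = ite b x z :=
  ifThenElse_left _ _ _ _

@[simp] theorem ite_right (b x y z : Decision X) : ite b x (ite b y z) = ite b x z :=
  ifThenElse_right _ _ _ _

theorem ite_comm (b c x y z w : Decision X) :
    ite b (ite c x y) (ite c z w) = ite c (ite b x z) (ite b y w) :=
  ifThenElse_comm _ _ _ _ _ _

theorem inf_eq_ite (b c : Decision X) : inf b c = ite b c bot := by
  have := ite_comm c b top bot bot bot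
  simp only [ite_self, ite_top_bot] at this
  exact (inf_eq_ifThenElse b c).trans this

theorem compl_eq_ite (b : Decision X) : compl b = ite b bot top := by
  conv_lhs => rw [← ite_top_bot b]
  refine (ifThenElse_comp b _ _ _).trans ?_
  unfold ite
  congr 1
  · exact (Category.assoc _ _ _).trans (congrArg _ (coprod.inl_desc _ _))
  · exact (Category.assoc _ _ _).trans (congrArg _ (coprod.inr_desc _ _))

/-- The lattice structure on decisions, with the join of `b` and `c` given by
"if `b` then `⊤` else `c`". -/
@[reducible]
def lattice (X : C) : Lattice (Decision X) :=
  letI : Min (Decision X) := ⟨inf⟩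
  letI : Max (Decision X) := ⟨fun b c => ite b top c⟩
  have hi : ∀ b c : Decision X, b ⊓ c = ite b c bot := inf_eq_ite
  have hs : ∀ b c : Decision X, b ⊔ c = ite b top c := fun _ _ => rfl
  Lattice.mk'
    (fun b c => by
      rw [hs, hs]
      have := ite_comm b c top top top bot
      simpa only [ite_self, ite_top_bot] using this)
    (fun b c d => by simp only [hs, ite_ite, top_ite])
    (fun b c => by
      rw [hi, hi]
      have := ite_comm b c top bot bot bot
      simpa only [ite_self, ite_top_bot] using this)
    (fun b c d => by simp only [hi, ite_ite, bot_ite])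
    (fun b c => by simp only [hi, hs, ite_right, ite_top_bot])
    (fun b c => by simp only [hi, hs, ite_left, ite_top_bot])

/-- Decisions form a Boolean algebra. -/
instance : BooleanAlgebra (Decision X) :=
  letI : Lattice (Decision X) := lattice X
  have hi : ∀ b c : Decision X, b ⊓ c = ite b c bot := inf_eq_ite
  have hs : ∀ b c : Decision X, b ⊔ c = ite b top c := fun _ _ => rfl
  have hle : ∀ b c : Decision X, b ≤ c ↔ b ⊔ c = c := fun _ _ => sup_eq_right.symm
  { DistribLattice.ofInfSupLe (α := Decision X) (fun b c d => by
      refine le_of_eq ?_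
      simp only [hi, hs, ite_ite, bot_ite, ite_right]
      have := ite_comm c b top top d bot
      simp only [ite_self] at this
      rw [this, ite_left]) with
    top := top
    bot := bot
    compl := compl
    le_top := fun b => (hle _ _).2 (ite_self _ _)
    bot_le := fun b => (hle _ _).2 (bot_ite _ _)
    inf_compl_le_bot := fun b => le_of_eq <| by
      change b ⊓ compl b = bot
      rw [hi, compl_eq_ite, ite_left, ite_self]
    top_le_sup_compl := fun b => le_of_eq <| by
      change top = b ⊔ compl b
      rw [hs, compl_eq_ite, ite_right, ite_self] }

theorem inf_def (b c : Decision X) : b ⊓ c = ite b c ⊥ := inf_eq_ite b c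

theorem sup_def (b c : Decision X) : b ⊔ c = ite b ⊤ c := rfl

theorem compl_def (b : Decision X) : bᶜ = ite b ⊥ ⊤ := compl_eq_ite b

theorem ite_eq_sup (b c d : Decision X) : ite b c d = (b ⊓ c) ⊔ (bᶜ ⊓ d) := by
  rw [inf_def, inf_def, sup_def, compl_def]
  change ite b c d = ite (ite b c bot) top (ite (ite b bot top) d bot)
  simp only [ite_ite, top_ite, bot_ite, ite_right]
  have := ite_comm c b top top bot d
  simp only [ite_self] at this
  rw [this, ite_left, ite_top_bot]

/-- The morphisms `X ⟶ Y` form a set over the Boolean algebra of decisions of `X`. -/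
instance homBSet (X Y : C) : BSet (Decision X) (X ⟶ Y) where
  cond := ifThenElse
  cond_self := ifThenElse_self
  cond_cond_left := ifThenElse_left
  cond_cond_right := ifThenElse_right
  cond_top := ifThenElse_top
  cond_compl b x y := by
    rw [compl_def]
    exact (ifThenElse_ite _ _ _ _ _).trans
      (congrArg₂ (ifThenElse b) (ifThenElse_bot _ _) (ifThenElse_top _ _))
  cond_inf b c x y := by
    rw [inf_def]
    exact (ifThenElse_ite _ _ _ _ _).trans (congrArg (ifThenElse b _) (ifThenElse_bot _ _))

end Decision

/-! ### Partitions coming from maps into copowers of the terminal object -/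

namespace Decision

variable {C : Type v} [Category.{u} C] [CartesianMonoidalCategory C]
  [HasCoproducts.{u} C] {X Y : C} {I : Type u}

variable (C I) in
/-- The copower of the terminal object by `I`. -/
abbrev Points : C := ∐ fun _ : I => 𝟙_ C

/-- The point of the copower with index `i`. -/
abbrev point (i : I) : 𝟙_ C ⟶ Points C I := Sigma.ι (fun _ : I => 𝟙_ C) i

section

variable [HasBinaryCoproducts C]

open Classical in
/-- The decision whether `h` takes the value `i`. -/
def component (h : X ⟶ Points C I) (i : I) : Decision X :=
  h ≫ Sigma.desc fun j => if j = i then iTop C else iBot C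

theorem component_comp (m : EndMonoid X) (h : X ⟶ Points C I) (i : I) :
    component ((show X ⟶ X from m) ≫ h) i = precomp m (component h i) := Category.assoc _ _ _

end

variable [MonoidalClosed C]

/-- The morphism that is `y i` where `h` takes the value `i`. -/
def select (h : X ⟶ Points C I) (y : I → (X ⟶ Y)) : X ⟶ Y := (isCopower_sigma I).case h y

theorem select_comp {Z : C} (h : X ⟶ Points C I) (y : I → (X ⟶ Y)) (f : Y ⟶ Z) :
    select h y ≫ f = select h fun i => y i ≫ f := IsCopower.case_comp _ _ _ _

@[simp] theorem select_const (h : X ⟶ Points C I) (y : X ⟶ Y) : select h (fun _ => y) = y :=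
  IsCopower.case_const _ _ _

theorem select_point (i : I) (y : I → (X ⟶ Y)) : select (toUnit X ≫ point i) y = y i :=
  IsCopower.case_point _ _ _

theorem select_eta (h : X ⟶ Points C I) : select h (fun i => toUnit X ≫ point i) = h :=
  IsCopower.case_eta _ _

theorem select_select (h : X ⟶ Points C I) (y : I → I → (X ⟶ Y)) :
    select h (fun i => select h (y i)) = select h fun i => y i i := IsCopower.case_case_self _ _ _

variable [HasBinaryCoproducts C]

/-- The decision that takes the value of `k i` where `h` takes the value `i`. -/
def selectDecision (h : X ⟶ Points C I) (k : I → Decision X) : Decision X :=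
  select h fun i => (k i).toHom

theorem select_ifThenElse (h : X ⟶ Points C I) (b : Decision X) (y z : I → (X ⟶ Y)) :
    select h (fun i => ifThenElse b (y i) (z i)) = ifThenElse b (select h y) (select h z) := by
  have := (isCopower_sigma (C := C) I).case_comm (isCopower_two C) h b.toHom
    fun i j => bif j then y i else z i
  rw [ifThenElse_eq_case]
  simp only [ifThenElse_eq_case]
  refine (Eq.trans ?_ this).trans ?_
  · unfold select
    congr 1
  · congr 1; funext i; cases i <;> rfl

theorem ifThenElse_select (h : X ⟶ Points C I) (b : I → Decision X) (y z : X ⟶ Y) :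
    ifThenElse (selectDecision h b) y z =
      select h fun i => ifThenElse (b i) y z := by
  simp only [ifThenElse_eq_case]
  exact (isCopower_sigma (C := C) I).case_case (isCopower_two C) h (fun i => (b i).toHom) _

open Classical in
theorem component_comp_desc {J : Type u} (h : X ⟶ Points C I) (α : I → J) (j : J) :
    component (h ≫ Sigma.desc fun i => point (α i)) j =
      selectDecision h fun i => if α i = j then ⊤ else ⊥ := by
  unfold component selectDecision
  conv_lhs => rw [← select_eta h]
  rw [Category.assoc, select_comp]
  congr 1
  funext i
  simp only [Category.assoc, Sigma.ι_desc_assoc, Sigma.ι_desc]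
  split_ifs <;> rfl

open Classical in
theorem component_eq_select (h : X ⟶ Points C I) (i : I) :
    component h i = selectDecision h fun j => if j = i then ⊤ else ⊥ := by
  rw [← component_comp_desc h fun i => i]
  congr 1
  rw [show Limits.Sigma.desc (fun i : I => point i) = 𝟙 (Points C I) from
    Sigma.hom_ext _ _ (by simp), Category.comp_id]

theorem component_select {J : Type u} (h : X ⟶ Points C I) (k : I → (X ⟶ Points C J)) (j : J) :
    component (select h k) j = selectDecision h fun i => component (k i) j :=
  select_comp _ _ _

theorem component_ifThenElse (b : Decision X) (h k : X ⟶ Points C I) (i : I) :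
    component (ifThenElse b h k) i = ite b (component h i) (component k i) :=
  ifThenElse_comp _ _ _ _

open Classical in
theorem component_point (i j : I) :
    component (toUnit X ≫ point i) j = if i = j then ⊤ else ⊥ := by
  rw [component_eq_select]
  exact select_point _ _

/-- In the branch `i` of a selection along `h`, the test whether `h` takes the value `i` is
vacuous. -/
@[simp]
theorem select_component (h : X ⟶ Points C I) (y z : I → (X ⟶ Y)) :
    select h (fun i => ifThenElse (component h i) (y i) (z i)) = select h y := by
  classical
  have := (isCopower_sigma (C := C) I).case_case_test (isCopower_two C) h
    (fun i => Sigma.desc fun j => if j = i then iTop C else iBot C)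
    fun i j => bif j then y i else z i
  simp only [ifThenElse_eq_case]
  unfold select
  refine (Eq.trans ?_ this).trans ?_
  · congr 1
  · congr 1
    funext i
    rw [Sigma.ι_desc, if_pos rfl]
    exact (isCopower_two C).case_point true _

theorem ifThenElse_component_select (h : X ⟶ Points C I) (i : I) (y : I → (X ⟶ Y)) (z : X ⟶ Y) :
    ifThenElse (component h i) (select h y) z = ifThenElse (component h i) (y i) z := by
  classical
  rw [component_eq_select, ifThenElse_select, ifThenElse_select]
  have e : ∀ j, ifThenElse (if j = i then ⊤ else ⊥ : Decision X) (select h y) z =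
      select h fun k => ifThenElse (if j = i then ⊤ else ⊥ : Decision X) (y k) z := by
    intro j
    rw [select_ifThenElse, select_const]
  simp only [e]
  rw [select_select]
  congr 1
  funext j
  split_ifs with hj
  · rw [hj]
  · exact (ifThenElse_bot _ _).trans (ifThenElse_bot _ _).symm

/-- Two families agreeing on the respective components of `h` have the same selection. -/
theorem select_congr (h : X ⟶ Points C I) {y y' : I → (X ⟶ Y)} (z : I → (X ⟶ Y))
    (e : ∀ i, ifThenElse (component h i) (y i) (z i) = ifThenElse (component h i) (y' i) (z i)) :
    select h y = select h y' := by
  rw [← select_component h y z, ← select_component h y' z]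
  simp only [e]

end Decision

/-! ### The topology on the Boolean algebra of decisions -/

namespace Decision

variable {C : Type v} [Category.{u} C] [CartesianMonoidalCategory C]
  [HasBinaryCoproducts C] [MonoidalClosed C] {X Y : C} {I : Type u}

theorem inf_eq_iff {p u v : Decision X} : p ⊓ u = p ⊓ v ↔ ite p u ⊥ = ite p v ⊥ := by
  rw [inf_def, inf_def]

variable [HasCoproducts.{u} C]

theorem selectDecision_congr (h : X ⟶ Points C I) {y y' : I → Decision X}
    (e : ∀ i, component h i ⊓ y i = component h i ⊓ y' i) :
    selectDecision h y = selectDecision h y' :=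
  select_congr h (fun _ => (⊥ : Decision X).toHom) fun i => inf_eq_iff.1 (e i)

@[simp]
theorem selectDecision_const (h : X ⟶ Points C I) (b : Decision X) :
    selectDecision h (fun _ => b) = b := select_const _ _

theorem component_inf_selectDecision (h : X ⟶ Points C I) (i : I) (k : I → Decision X) :
    component h i ⊓ selectDecision h k = component h i ⊓ k i :=
  inf_eq_iff.2 (ifThenElse_component_select h i _ _)

theorem selectDecision_inf (h : X ⟶ Points C I) (k : I → Decision X) (b : Decision X) :
    selectDecision h k ⊓ b = selectDecision h fun i => k i ⊓ b := by
  simp only [inf_def]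
  exact ifThenElse_select h k _ _

open Classical in
theorem component_inf_component (h : X ⟶ Points C I) {i j : I} (hij : i ≠ j) :
    component h i ⊓ component h j = ⊥ := by
  rw [component_eq_select h j, component_inf_selectDecision, if_neg hij, inf_bot_eq]

/-- The components of a map into a copower have join `⊤`. -/
theorem eq_top_of_component_le (h : X ⟶ Points C I) {b : Decision X}
    (hb : ∀ i, component h i ≤ b) : b = ⊤ := by
  have : selectDecision h (fun _ => b) = selectDecision h fun _ => ⊤ :=
    selectDecision_congr h fun i => by rw [inf_top_eq, inf_eq_left]; exact hb i
  simpa using this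

open Classical in
theorem component_desc (h : X ⟶ Points C I) {J : Type u} (α : I → J) (j : J) :
    IsLUB {x | ∃ i, α i = j ∧ x = component h i}
      (component (h ≫ Limits.Sigma.desc fun i => point (α i)) j) := by
  rw [component_comp_desc]
  constructor
  · rintro _ ⟨i, hi, rfl⟩
    rw [← inf_eq_left, component_inf_selectDecision, if_pos hi, inf_top_eq]
  · intro b hb
    rw [← inf_eq_left, selectDecision_inf]
    refine selectDecision_congr h fun i => ?_
    split_ifs with hi
    · rw [top_inf_eq, inf_top_eq, inf_eq_left]
      exact hb ⟨i, hi, rfl⟩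
    · rw [bot_inf_eq]

theorem isCover_iff {P : Set (Decision X)} :
    IsCover P ↔ ⊥ ∉ P ∧ ∃ f : X ⟶ Points C P, ∀ c : P, component f c = c := by
  unfold IsCover component
  refine and_congr Iff.rfl (exists_congr fun f => forall_congr' fun c => ?_)
  exact Eq.congr (by congr!) rfl

theorem IsCover.isPartition {P : Set (Decision X)} (hP : IsCover P) : IsPartition P ⊤ := by
  obtain ⟨h0, f, hf⟩ := isCover_iff.1 hP
  refine ⟨h0, ⟨fun _ _ => le_top, fun b hb => ?_⟩, fun c hc d hd hcd => ?_⟩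
  · refine (eq_top_of_component_le f fun i => ?_).ge
    rw [hf]
    exact hb i.2
  · have := component_inf_component f (i := ⟨c, hc⟩) (j := ⟨d, hd⟩) fun h =>
      hcd (congrArg Subtype.val h)
    rwa [hf, hf] at this

/-- The non-zero components of a map into a copower of the terminal object form a cover. -/
theorem isCover_range [Nontrivial (Decision X)] (h : X ⟶ Points C I) :
    IsCover (Set.range (component h) \ {⊥}) := by
  classical
  refine isCover_iff.2 ⟨fun h => h.2 rfl, ?_⟩
  have hne : ∃ i, component h i ≠ ⊥ := by
    by_contra! hc
    exact bot_ne_top (eq_top_of_component_le h (b := ⊥) fun i => (hc i).le)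
  obtain ⟨i₀, hi₀⟩ := hne
  let r : I → (Set.range (component h) \ {⊥} : Set (Decision X)) := fun i =>
    if hi : component h i = ⊥ then ⟨component h i₀, ⟨i₀, rfl⟩, hi₀⟩
    else ⟨component h i, ⟨i, rfl⟩, hi⟩
  refine ⟨h ≫ Limits.Sigma.desc fun i => point (r i), ?_⟩
  rintro ⟨_, ⟨i, rfl⟩, hi⟩
  rw [component_comp_desc]
  refine Eq.trans ?_ (component_eq_select h i).symm
  refine selectDecision_congr h fun j => ?_
  by_cases hj : component h j = ⊥
  · rw [hj, bot_inf_eq, bot_inf_eq]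
  · congr 1
    have : (r j = ⟨component h i, ⟨i, rfl⟩, hi⟩) ↔ j = i := by
      simp only [r, dif_neg hj]
      refine Subtype.ext_iff.trans ⟨fun e => ?_, fun e => congrArg (component h) e⟩
      -- distinct indices have disjoint components
      by_contra hji
      have := component_inf_component h hji
      rw [show component h j = component h i from e, inf_idem] at this
      exact hi this
    simp only [this]

theorem eq_of_forall_inf_eq {B : Type*} [BooleanAlgebra B] {P : Set B} (hP : IsLUB P ⊤) {b c : B}
    (h : ∀ p ∈ P, p ⊓ b = p ⊓ c) : b = c := by
  have key : ∀ {b c : B}, (∀ p ∈ P, p ⊓ b = p ⊓ c) → b ≤ c := by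
    intro b c h
    have : (⊤ : B) ≤ b ⇨ c := hP.2 fun p hp => by
      rw [le_himp_iff, h p hp]
      exact inf_le_right
    rwa [top_le_iff, himp_eq_top_iff] at this
  exact le_antisymm (key h) (key fun p hp => (h p hp).symm)

theorem isCover_of_finite [Nontrivial (Decision X)] {P : Set (Decision X)} (hf : P.Finite)
    (hP : IsPartition P ⊤) : IsCover P := by
  classical
  refine isCover_iff.2 ⟨hP.bot_notMem, ?_⟩
  have hne : P.Nonempty := by
    rw [Set.nonempty_iff_ne_empty]
    rintro rfl
    exact bot_ne_top (isLUB_empty.unique hP.isLUB)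
  obtain ⟨p₀, hp₀⟩ := hne
  obtain ⟨f, hf'⟩ := BSet.exists_agree_of_finset (W := X ⟶ Points C P) hf.toFinset
    (fun c hc d hd => hP.disjoint c (hf.mem_toFinset.1 hc) d (hf.mem_toFinset.1 hd))
    fun c => if hc : c ∈ P then toUnit X ≫ point (⟨c, hc⟩ : P) else toUnit X ≫ point ⟨p₀, hp₀⟩
  refine ⟨f, fun c => eq_of_forall_inf_eq hP.isLUB fun p hp => ?_⟩
  have h : p ⊓ component f c = p ⊓ component (toUnit X ≫ point (⟨p, hp⟩ : P)) c := by
    have h := BSet.agree_iff.1 (hf' p (hf.mem_toFinset.2 hp)) (toUnit X ≫ point ⟨p₀, hp₀⟩)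
    rw [dif_pos hp] at h
    have h' := congrArg (fun k => ite p (component k c) ⊥) h
    simp only [BSet.cond, component_ifThenElse, ite_left] at h'
    rw [inf_def, h', ← inf_def]
  rw [h, component_point]
  split_ifs with e
  · rw [inf_top_eq, ← e, inf_idem]
  · rw [inf_bot_eq, hP.disjoint p hp c c.2 fun h => e (Subtype.ext h)]

variable (X) in
/-- The topology on `C(X, 1 + 1)` whose covers are the partitions classified by maps into
copowers of the terminal object. -/
def topology [Nontrivial (Decision X)] : ZeroDimTopology (Decision X) where
  covers := {P | IsCover P}
  isPartition _ hP := hP.isPartition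
  finite_mem _ hf hP := isCover_of_finite hf hP
  refine_mem P hP Q hQ := by
    classical
    obtain ⟨-, f, hf⟩ := isCover_iff.1 hP
    choose k hk using fun b => (isCover_iff.1 (hQ b)).2
    let h : X ⟶ Points C (Σ b : P, Q b) :=
      select f fun b => k b ≫ Limits.Sigma.desc fun c => point (⟨b, c⟩ : Σ b : P, Q b)
    have hc : ∀ i : Σ b : P, Q b, component h i = (i.1 : Decision X) ⊓ i.2 := by
      rintro ⟨b, c⟩
      have e : component f b ⊓ component (k b) c = component h ⟨b, c⟩ := by
        rw [component_select, component_eq_select f b, selectDecision_inf]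
        congr 1
        funext b'
        rw [component_comp_desc]
        split_ifs with hb
        · subst hb
          rw [top_inf_eq, component_eq_select]
          congr 1
          funext c'
          simp
        · rw [bot_inf_eq]
          symm
          convert selectDecision_const (k b') ⊥ using 2
          funext c'
          rw [if_neg]
          intro h
          exact hb (congrArg Sigma.fst h)
      rw [← e, hf, hk]
    change IsCover _
    convert isCover_range h using 2
    ext x
    constructor
    · rintro ⟨b, c, hcQ, rfl⟩
      exact ⟨⟨b, c, hcQ⟩, hc _⟩
    · rintro ⟨⟨b, c⟩, rfl⟩
      exact ⟨b, c, c.2, hc _⟩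
  coarsen_mem P hP I α hα := by
    obtain ⟨h0, f, hf⟩ := isCover_iff.1 hP
    let h : X ⟶ Points C I := f ≫ Limits.Sigma.desc fun b => point (α b)
    have hL : ∀ i, IsLUB {x | ∃ b : P, α b = i ∧ x = (b : Decision X)} (component h i) := by
      intro i
      have := component_desc f α i
      simpa only [hf] using this
    refine ⟨component h, hL, ?_⟩
    have : Set.range (component h) \ {⊥} = Set.range (component h) := by
      refine Set.sdiff_singleton_eq_self ?_
      rintro ⟨i, hi⟩
      obtain ⟨b, rfl⟩ := hα i
      have := (hL (α b)).1 ⟨b, rfl, rfl⟩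
      rw [hi, le_bot_iff] at this
      exact h0 (this ▸ b.2)
    rw [← this]
    exact isCover_range h

end Decision

/-! ### The matched pair of an object and the functor it represents -/

namespace Decision

variable {C : Type v} [Category.{u} C] [CartesianMonoidalCategory C]
  [HasCoproducts.{u} C]

/-- The index and the endomorphism into which a map from `X` to a copower of `X` decomposes. -/
def copowerSplit (X : C) (I : Type u) : ∐ (fun _ : I => X) ⟶ X ⊗ Points C I :=
  Limits.Sigma.desc fun i => lift (𝟙 X) (toUnit X ≫ point i)

theorem ι_copowerSplit {X : C} {I : Type u} (i : I) :
    Sigma.ι (fun _ : I => X) i ≫ copowerSplit X I = lift (𝟙 X) (toUnit X ≫ point i) := by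
  simp [copowerSplit]

theorem select_copowerSplit [MonoidalClosed C] {X : C} {I : Type u} (ω : X ⟶ ∐ fun _ : I => X) :
    select (ω ≫ copowerSplit X I ≫ snd _ _)
      (fun i => (ω ≫ copowerSplit X I ≫ fst _ _) ≫ Sigma.ι (fun _ : I => X) i) = ω := by
  have : copowerSplit X I ≫ (isCopower_sigma I).desc (Sigma.ι fun _ : I => X) = 𝟙 _ :=
    Sigma.hom_ext _ _ fun i => by
      rw [← Category.assoc, ι_copowerSplit, IsCopower.fac, Category.comp_id]
  unfold select
  rw [← IsCopower.lift_desc, ← comp_lift, ← comp_lift, lift_fst_snd, Category.comp_id,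
    Category.assoc, this, Category.comp_id]

variable [HasBinaryCoproducts C] [MonoidalClosed C]

/-- An endomorphism of `X` as an element of the monoid `C(X, X)`. -/
def endo {X : C} (m : X ⟶ X) : EndMonoid X := m

/-- Covers act on the morphisms `X ⟶ Y` by selection. -/
instance homBJSet (X Y : C) [Nontrivial (Decision X)] : BJSet (topology X) (X ⟶ Y) where
  glue _ hP _ x := select (isCover_iff.1 hP).2.choose x
  glue_const _ _ _ _ := select_const _ _
  glue_cond P hP _ x y := by
    have hf := (isCover_iff.1 hP).2.choose_spec
    set f := (isCover_iff.1 hP).2.choose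
    have := select_component f x y
    simp only [hf] at this
    exact this
  cond_glue P hP _ x b := by
    have hf := (isCover_iff.1 hP).2.choose_spec
    set f := (isCover_iff.1 hP).2.choose
    have := ifThenElse_component_select f b x (x b)
    rw [hf] at this
    exact this.trans (ifThenElse_self _ _)

/-- The matched pair determined by an object `X` with at least two decisions. -/
def matchedPair (X : C) [Nontrivial (Decision X)] :
    MatchedPair (Decision X) (EndMonoid X) where
  nondegenerate := bot_ne_top
  J := topology X
  bSet := homBSet X X
  bjSet := homBJSet X X
  star := precomp
  one_star b := Category.id_comp b.toHom
  mul_star m n b := Category.assoc (show X ⟶ X from m) (show X ⟶ X from n) b.toHom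
  star_top := precomp_top
  star_compl m b := (Category.assoc (show X ⟶ X from m) b.toHom _).symm
  star_inf m b c := by
    change precomp m (inf b c) = inf (precomp m b) (precomp m c)
    exact (comp_lift_assoc _ _ _ _)
  star_covers m P hP := by
    obtain ⟨-, f, hf⟩ := isCover_iff.1 hP
    have e : ∀ c : P, component ((show X ⟶ X from m) ≫ f) c = precomp m c := fun c =>
      (component_comp m f c).trans (congrArg (precomp m) (hf c))
    change IsCover _
    convert isCover_range ((show X ⟶ X from m) ≫ f) using 2
    ext x
    simp [e]
  cond_mul b m n p := ifThenElse_comp b _ _ _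
  mul_cond m b n p := comp_ifThenElse _ _ _
  cond_star b m n c := by
    rw [← ite_eq_sup]
    exact ifThenElse_comp b _ _ _

theorem matchedPair_isDefinedFrom (X : C) [Nontrivial (Decision X)] :
    (matchedPair X).IsDefinedFrom X where
  top_eq := rfl
  compl_eq _ := rfl
  inf_eq _ _ := rfl
  mem_covers _ := Iff.rfl
  star_eq _ _ := rfl
  cond_eq _ _ _ := rfl

/-- The morphisms `X ⟶ Y` as a set for the matched pair of `X`. -/
def homSet (X Y : C) [Nontrivial (Decision X)] : (matchedPair X).SetOver where
  carrier := X ⟶ Y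
  bSet := homBSet X Y
  bjSet := homBJSet X Y
  action :=
    { smul := fun m y => (show X ⟶ X from m) ≫ y
      one_smul := fun y => Category.id_comp y
      mul_smul := fun m n y => Category.assoc (show X ⟶ X from m) (show X ⟶ X from n) y }
  cond_smul b _ _ _ := ifThenElse_comp b _ _ _
  smul_cond _ _ _ _ := comp_ifThenElse _ _ _

/-- The functor sending `Y` to the set of morphisms `X ⟶ Y`. -/
def homFunctor (X : C) [Nontrivial (Decision X)] : C ⥤ (matchedPair X).SetOver where
  obj Y := homSet X Y
  map {Y Z} f := MatchedPair.homOfCond (V := homSet X Y) (W := homSet X Z)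
    (fun y : X ⟶ Y => y ≫ f) (fun b _ _ => ifThenElse_comp b _ _ _)
    (fun m _ => Category.assoc (show X ⟶ X from m) _ _)
  map_id Y := MatchedPair.setHom_ext fun y => Category.comp_id (show X ⟶ Y from y)
  map_comp f g := MatchedPair.setHom_ext fun y =>
    (Category.assoc (show X ⟶ _ from y) f g).symm

open BSet

/-- Every map from `X` to a copower of `X` agrees with a multiple of a coprojection on each of the
components of its index. -/
theorem agree_copowerSplit {X : C} {I : Type u} (ω : X ⟶ ∐ fun _ : I => X) (i : I) :
    Agree (component (ω ≫ copowerSplit X I ≫ snd _ _) i) ω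
      ((ω ≫ copowerSplit X I ≫ fst _ _) ≫ Sigma.ι (fun _ : I => X) i) := by
  refine agree_iff.2 fun z => ?_
  have := ifThenElse_component_select (ω ≫ copowerSplit X I ≫ snd _ _) i
    (fun i => (ω ≫ copowerSplit X I ≫ fst _ _) ≫ Sigma.ι (fun _ : I => X) i) z
  rw [select_copowerSplit] at this
  exact this

variable {X : C} [Nontrivial (Decision X)] {I : Type u} {W : (matchedPair X).SetOver}

/-- Elements of a set over the matched pair of `X` are determined by their restrictions to the
components of a map into a copower. -/
theorem eq_of_agree_component (h : X ⟶ Points C I) {x y : W.carrier}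
    (e : ∀ i, Agree (component h i) x y) : x = y :=
  BJSet.eq_of_agree (matchedPair X).J (isCover_range h) <| by
    rintro _ ⟨⟨i, rfl⟩, -⟩
    exact e i

/-- Elements of a set over the matched pair of `X` can be glued along the components of a map
into a copower. -/
theorem exists_agree_component (h : X ⟶ Points C I) (w : I → W.carrier) :
    ∃ t : W.carrier, ∀ i, Agree (component h i) t (w i) := by
  classical
  have hne : ∃ i, component h i ≠ ⊥ := by
    by_contra! hc
    exact bot_ne_top (eq_top_of_component_le h (b := ⊥) fun i => (hc i).le)
  obtain ⟨i₀, -⟩ := hne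
  obtain ⟨t, ht⟩ := BJSet.exists_agree (matchedPair X).J (isCover_range h)
    fun b => if hb : ∃ i, component h i = b then w hb.choose else w i₀
  refine ⟨t, fun i => ?_⟩
  by_cases hi : component h i = ⊥
  · rw [hi]
    exact agree_bot _ _
  · have := ht _ ⟨⟨i, rfl⟩, hi⟩
    have hb : ∃ j, component h j = component h i := ⟨i, rfl⟩
    rw [dif_pos hb] at this
    have hc : hb.choose = i := by
      by_contra hne
      have h₁ := component_inf_component h hne
      rw [hb.choose_spec, inf_idem] at h₁
      exact hi h₁
    rwa [hc] at this

/-- Homomorphisms preserve restriction. -/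
theorem agree_map {V : (matchedPair X).SetOver} (f : V ⟶ W) {b : Decision X} {x y : V.carrier}
    (h : Agree b x y) : Agree b (MatchedPair.SetHom.map f x) (MatchedPair.SetHom.map f y) := by
  unfold Agree
  rw [← f.map_cond, show cond b x y = y from h]

/-- The copower of `X` by `I` is generated by the coprojections. -/
theorem copower_hom_ext {f g : homSet X (∐ fun _ : I => X) ⟶ W}
    (h : ∀ i, MatchedPair.SetHom.map f (Sigma.ι (fun _ : I => X) i) =
      MatchedPair.SetHom.map g (Sigma.ι (fun _ : I => X) i)) : f = g := by
  refine MatchedPair.setHom_ext fun ω => ?_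
  refine eq_of_agree_component ((show X ⟶ ∐ fun _ : I => X from ω) ≫ copowerSplit X I ≫ snd _ _)
    fun i => ?_
  have hω := agree_copowerSplit ω i
  refine (agree_map f hω).trans (Agree.trans ?_ (agree_map g hω).symm)
  have e : ∀ f : homSet X (∐ fun _ : I => X) ⟶ W, MatchedPair.SetHom.map f
      ((ω ≫ copowerSplit X I ≫ fst _ _) ≫ Sigma.ι (fun _ : I => X) i) =
      endo (ω ≫ copowerSplit X I ≫ fst _ _) •
        MatchedPair.SetHom.map f (Sigma.ι (fun _ : I => X) i) := fun f => f.map_smul _ _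
  rw [e, e, h]
  exact cond_self _ _

theorem agree_smul (m : EndMonoid X) {b : Decision X} {x y : W.carrier} (h : Agree b x y) :
    Agree (precomp m b) (m • x) (m • y) := by
  have := W.smul_cond m b x y
  rw [show cond b x y = y from h] at this
  exact this.symm

/-- The copower of `X` by `I` is free on the coprojections. -/
theorem exists_copower_hom (w : I → W.carrier) :
    ∃ f : homSet X (∐ fun _ : I => X) ⟶ W,
      ∀ i, MatchedPair.SetHom.map f (Sigma.ι (fun _ : I => X) i) = w i := by
  choose ε hε using fun ω : X ⟶ ∐ fun _ : I => X =>
    exists_agree_component (ω ≫ copowerSplit X I ≫ snd _ _)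
      fun i => endo (ω ≫ copowerSplit X I ≫ fst _ _) • w i
  have hcond : ∀ (b : Decision X) (ω ω' : X ⟶ ∐ fun _ : I => X),
      ε (ifThenElse b ω ω') = cond b (ε ω) (ε ω') := by
    intro b ω ω'
    refine eq_of_agree_component (ifThenElse b ω ω' ≫ copowerSplit X I ≫ snd _ _)
      fun i => (hε _ i).trans ?_
    rw [ifThenElse_comp, component_ifThenElse, ite_eq_sup, ifThenElse_comp]
    refine Agree.trans ?_ ((hε ω i).cond_cond (hε ω' i)).symm
    rw [← W.cond_smul]
    exact cond_self _ _
  have hsmul : ∀ (m : X ⟶ X) (ω : X ⟶ ∐ fun _ : I => X), ε (m ≫ ω) = endo m • ε ω := by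
    intro m ω
    refine eq_of_agree_component (m ≫ ω ≫ copowerSplit X I ≫ snd _ _) fun i => ?_
    have h := hε (m ≫ ω) i
    rw [Category.assoc, Category.assoc] at h
    rw [show component (m ≫ ω ≫ copowerSplit X I ≫ snd _ _) i = precomp (endo m)
      (component (ω ≫ copowerSplit X I ≫ snd _ _) i) from component_comp (endo m) _ i] at h ⊢
    refine h.trans ?_
    refine Agree.trans ?_ (agree_smul (endo m) (hε ω i)).symm
    rw [← mul_smul]
    exact cond_self _ _
  refine ⟨MatchedPair.homOfCond (V := homSet X (∐ fun _ : I => X)) ε hcond hsmul, fun i => ?_⟩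
  refine eq_of_agree_component (Sigma.ι (fun _ : I => X) i ≫ copowerSplit X I ≫ snd _ _)
    fun j => (hε _ j).trans ?_
  rw [← Category.assoc, ← Category.assoc, ι_copowerSplit, lift_snd, lift_fst]
  classical
  rw [component_point]
  split_ifs with e
  · subst e
    exact agree_top.2 (one_smul (EndMonoid X) _)
  · exact agree_bot _ _

end Decision

/-! ### Varieties -/

namespace Theory

variable {S : Type u} {T : Theory S}

theorem Alg.epi_of_surjective {A B : T.Alg} (f : A ⟶ B)
    (h : ∀ s, Function.Surjective (f.map s)) : Epi f :=
  ⟨fun _ _ e => Alg.hom_ext fun s y => by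
    obtain ⟨x, rfl⟩ := h s y
    exact congrArg (fun f : A ⟶ _ => Hom.map f s x) e⟩

theorem Alg.mono_of_injective {A B : T.Alg} (f : A ⟶ B)
    (h : ∀ s, Function.Injective (f.map s)) : Mono f :=
  ⟨fun {Z} _ _ e => Alg.hom_ext fun s z =>
    h s (congrArg (fun f : Z ⟶ _ => Hom.map f s z) e)⟩

/-- The support of an algebra `A`: the image of `A` in the terminal algebra. -/
def Alg.support (A : T.Alg) : T.Alg where
  carrier s := ULift (PLift (Nonempty (A.carrier s)))
  op o a := ⟨⟨⟨A.op o fun i => (a i).down.down.some⟩⟩⟩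
  eqn _ _ := Subsingleton.elim (α := ULift (PLift _)) _ _

/-- In a balanced variety an algebra is well-supported only if all its sorts are inhabited: the
inclusion of its support in `1` is then monic and epic. -/
theorem Alg.nonempty_of_epi_toUnit [Balanced T.Alg] (A : T.Alg) [Epi (toUnit A)] (s : S) :
    Nonempty (A.carrier s) := by
  let q : A ⟶ A.support := Hom.mk (fun _ x => ⟨⟨⟨x⟩⟩⟩) fun _ _ => rfl
  have hq : q ≫ toUnit A.support = toUnit A := toUnit_unique _ _
  have : Epi (q ≫ toUnit A.support) := by rw [hq]; infer_instance
  have : Epi (toUnit A.support) := epi_of_epi q _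
  have : Mono (toUnit A.support) := Alg.mono_of_injective _ fun _ _ _ _ =>
    Subsingleton.elim (α := ULift (PLift _)) _ _
  have : IsIso (toUnit A.support) := isIso_of_mono_of_epi _
  exact (Hom.map (inv (toUnit A.support)) s PUnit.unit).down.down

theorem Alg.epi_toUnit (A : T.Alg) (h : ∀ s, Nonempty (A.carrier s)) : Epi (toUnit A) :=
  Alg.epi_of_surjective _ fun s _ => ⟨(h s).some, rfl⟩

/-- A homomorphism factors through any surjective homomorphism with smaller kernel. -/
theorem Alg.exists_factor {A B Z : T.Alg} (q : A ⟶ B) (hq : ∀ s, Function.Surjective (q.map s))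
    (f : A ⟶ Z) (h : ∀ s x y, q.map s x = q.map s y → f.map s x = f.map s y) :
    ∃ k : B ⟶ Z, q ≫ k = f := by
  have hs := fun s => Function.surjInv_eq (hq s)
  refine ⟨Hom.mk (fun s y => f.map s (Function.surjInv (hq s) y)) fun o a => ?_,
    Alg.hom_ext fun s x => h _ _ _ (hs s _)⟩
  rw [← f.map_op]
  refine h _ _ _ ?_
  rw [hs, q.map_op]
  simp only [hs]

/-- A surjective family of maps out of an algebra whose kernel is a congruence defines a quotient
algebra with the same kernel. -/
theorem Alg.exists_quotient (A : T.Alg) {Z : S → Type u} (q : ∀ s, A.carrier s → Z s)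
    (hq : ∀ s, Function.Surjective (q s))
    (h : ∀ (o : T.Op) (a a' : ∀ i, A.carrier (T.dom o i)),
      (∀ i, q _ (a i) = q _ (a' i)) → q _ (A.op o a) = q _ (A.op o a')) :
    ∃ (B : T.Alg) (p : A ⟶ B), (∀ s, Function.Surjective (p.map s)) ∧
      ∀ s x y, p.map s x = p.map s y ↔ q s x = q s y := by
  have hs := fun s => Function.surjInv_eq (hq s)
  let op : ∀ o : T.Op, (∀ i, Z (T.dom o i)) → Z (T.cod o) := fun o z =>
    q _ (A.op o fun i => Function.surjInv (hq _) (z i))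
  have hop : ∀ o a, q _ (A.op o a) = op o fun i => q _ (a i) := fun o a =>
    h _ _ _ fun i => (hs _ _).symm
  let B : T.Alg :=
    { carrier := Z
      op := op
      eqn := fun e v => by
        have key : v = fun s x => q s (Function.surjInv (hq s) (v s x)) :=
          funext fun s => funext fun x => (hs s _).symm
        rw [key, ← eval_hom q hop, ← eval_hom q hop, A.eqn] }
  exact ⟨B, Hom.mk q hop, hq, fun _ _ _ => Iff.rfl⟩

namespace IsFreeOnOneOfEachSort

variable {X : T.Alg} {g : ∀ s, X.carrier s} 

theorem hom_ext (hX : IsFreeOnOneOfEachSort X g) {Y : T.Alg} {f f' : X ⟶ Y}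
    (h : ∀ s, f.map s (g s) = f'.map s (g s)) : f = f' :=
  (hX Y fun s => f'.map s (g s)).unique h fun _ => rfl

variable (hX : IsFreeOnOneOfEachSort X g)

/-- The homomorphism out of the free algebra with given values on the generators. -/
def lift {Y : T.Alg} (y : ∀ s, Y.carrier s) : X ⟶ Y := (hX Y y).exists.choose

@[simp]
theorem lift_gen {Y : T.Alg} (y : ∀ s, Y.carrier s) (s : S) : (hX.lift y).map s (g s) = y s :=
  (hX Y y).exists.choose_spec s

end IsFreeOnOneOfEachSort

/-- The objects of the two-valued collapse are initial or have all sorts inhabited. -/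
theorem nonempty_or_isInitial [Balanced T.Alg] {Y : T.Alg} (hY : IsTwoValued T.Alg Y) :
    (∀ s, Nonempty (Y.carrier s)) ∨ Nonempty (IsInitial Y) :=
  hY.imp_left fun (_ : Epi (toUnit Y)) => Alg.nonempty_of_epi_toUnit Y

section Topos

variable [MonoidalClosed T.Alg]

/-- If the two points of `1 + 1` agree then so do all parallel morphisms. -/
theorem hom_eq_of_iTop_eq_iBot (h : iTop T.Alg = iBot T.Alg) {Y Z : T.Alg} (f f' : Y ⟶ Z) :
    f = f' := by
  have h₁ := (isCopower_two T.Alg).fac (fun i => bif i then f else f') true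
  have h₂ := (isCopower_two T.Alg).fac (fun i => bif i then f else f') false
  exact h₁.symm.trans (Eq.trans (congrArg (fun k => CartesianMonoidalCategory.lift (𝟙 Y)
    (toUnit Y ≫ k) ≫ _) h) h₂)

/-- No homomorphism leads from an object with two distinct decisions to an initial object, since
initial objects are strict. -/
theorem isEmpty_hom_of_isInitial {X : T.Alg} [Nontrivial (Decision X)] {Y : T.Alg} (hY : IsInitial Y) :
    IsEmpty (X ⟶ Y) := by
  refine ⟨fun f => ?_⟩
  have := strict_initial hY f
  obtain ⟨b, c, h⟩ := exists_pair_ne (Decision X)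
  exact h ((hY.ofIso (asIso f).symm).hom_ext _ _)

variable [Balanced T.Alg]

theorem iTop_ne_iBot (hnd : IsEmpty (IsInitial (𝟙_ T.Alg))) : iTop T.Alg ≠ iBot T.Alg := by
  intro h
  have : Epi (initial.to (𝟙_ T.Alg)) := ⟨fun _ _ _ => hom_eq_of_iTop_eq_iBot h _ _⟩
  have : IsIso (initial.to (𝟙_ T.Alg)) := isIso_of_mono_of_epi _
  exact hnd.false (initialIsInitial.ofIso (asIso (initial.to (𝟙_ T.Alg))))

variable {X : T.Alg} {g : ∀ s, X.carrier s}

theorem nontrivial_decision (hnd : IsEmpty (IsInitial (𝟙_ T.Alg))) (g : ∀ s, X.carrier s) :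
    Nontrivial (Decision X) := by
  have : Epi (toUnit X) := Alg.epi_toUnit X fun s => ⟨g s⟩
  exact ⟨Decision.top, Decision.bot, fun h =>
    iTop_ne_iBot hnd ((cancel_epi (toUnit X)).1 h)⟩

end Topos

end Theory

/-! ### The two-valued collapse of a variety as a category of sets over a matched pair -/

namespace Theory

variable {S : Type u} {T : Theory S} {X : T.Alg} {g : ∀ s, X.carrier s}

open MatchedPair (SetHom homOfCond)
open Decision

/-- The coprojection of the copower of `X` by `I` with index `i`. -/
abbrev copowerι (X : T.Alg) {I : Type u} (i : I) : X ⟶ ∐ fun _ : I => X :=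
  Sigma.ι (fun _ : I => X) i

namespace IsFreeOnOneOfEachSort

open Classical in
/-- The homomorphism out of the free algebra that takes the value `τ` on the generator of sort `s`
and the values `v` on the other generators. -/
def spread (hX : IsFreeOnOneOfEachSort X g) {Y : T.Alg} (v : ∀ s, Y.carrier s) (s : S)
    (τ : Y.carrier s) : X ⟶ Y :=
  hX.lift (Function.update v s τ)

@[simp]
theorem spread_gen_self (hX : IsFreeOnOneOfEachSort X g) {Y : T.Alg} (v : ∀ s, Y.carrier s) (s : S) (τ : Y.carrier s) :
    (hX.spread v s τ).map s (g s) = τ := by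
  simp [spread]

theorem spread_gen_of_ne (hX : IsFreeOnOneOfEachSort X g) {Y : T.Alg} (v : ∀ s, Y.carrier s) {s s' : S} (τ : Y.carrier s)
    (h : s' ≠ s) : (hX.spread v s τ).map s' (g s') = v s' := by
  simp [spread, h]

/-- An algebra with inhabited sorts is a quotient of a copower of the free algebra. -/
theorem surjective_counit (hX : IsFreeOnOneOfEachSort X g) {Y : T.Alg} (y₀ : ∀ s, Y.carrier s) (s : S) :
    Function.Surjective
      ((Limits.Sigma.desc fun y : X ⟶ Y => y : (∐ fun _ : X ⟶ Y => X) ⟶ Y).map s) := fun a => by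
  let y : X ⟶ Y := hX.spread y₀ s a
  refine ⟨(copowerι X y).map s (g s), ?_⟩
  have := congrArg (fun f : X ⟶ Y => f.map s (g s))
    (Sigma.ι_desc (fun y : X ⟶ Y => y) y)
  exact this.trans (hX.spread_gen_self _ _ _)

theorem hom_eq_of_forall_comp_eq (hX : IsFreeOnOneOfEachSort X g) {Y Z : T.Alg} (y₀ : ∀ s, Y.carrier s) {k k' : Y ⟶ Z}
    (h : ∀ y : X ⟶ Y, y ≫ k = y ≫ k') : k = k' :=
  Alg.hom_ext fun s a => by
    have := congrArg (fun f : X ⟶ Z => f.map s (g s)) (h (hX.spread y₀ s a))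
    simpa using this

/-- The map to the copower of `1` by the set of sorts that takes the value `s` at sort `s`. -/
def sortMap (hX : IsFreeOnOneOfEachSort X g) : X ⟶ Points T.Alg S :=
  hX.lift fun s => (show 𝟙_ T.Alg ⟶ Points T.Alg S from point s).map s PUnit.unit

variable [MonoidalClosed T.Alg]

theorem exists_map_eq (hX : IsFreeOnOneOfEachSort X g) [Nontrivial (Decision X)] {Y Z : T.Alg} (y₀ : ∀ s, Y.carrier s)
    (f : homSet X Y ⟶ homSet X Z) : ∃ k : Y ⟶ Z, (homFunctor X).map k = f := by
  let q : (∐ fun _ : X ⟶ Y => X) ⟶ Y := Limits.Sigma.desc fun y => y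
  let r : (∐ fun _ : X ⟶ Y => X) ⟶ Z := Limits.Sigma.desc fun y => SetHom.map f y
  have hqr : (homFunctor X).map q ≫ f = (homFunctor X).map r := copower_hom_ext fun y => by
    change SetHom.map f (copowerι X y ≫ q) = copowerι X y ≫ r
    exact (congrArg (SetHom.map f) (Sigma.ι_desc _ _)).trans (Sigma.ι_desc _ _).symm
  have hqr' : ∀ ω : X ⟶ ∐ fun _ : X ⟶ Y => X, SetHom.map f (ω ≫ q) = ω ≫ r := fun ω =>
    congrArg (fun k : homSet X _ ⟶ homSet X Z => SetHom.map k ω) hqr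
  obtain ⟨k, hk⟩ := Alg.exists_factor q (hX.surjective_counit y₀) r fun s τ τ' e => by
    let v : ∀ s, (∐ fun _ : X ⟶ Y => X : T.Alg).carrier s := fun s =>
      (copowerι X (hX.lift y₀)).map s (g s)
    have hω : hX.spread v s τ ≫ q = hX.spread v s τ' ≫ q := hX.hom_ext fun s' => by
      rw [Alg.comp_map, Alg.comp_map]
      by_cases hs : s' = s
      · subst hs
        rwa [spread_gen_self, spread_gen_self]
      · rw [hX.spread_gen_of_ne _ _ hs, hX.spread_gen_of_ne _ _ hs]
    have h := hqr' (hX.spread v s τ)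
    rw [hω, hqr'] at h
    have := congrArg (fun f : X ⟶ Z => f.map s (g s)) h
    simpa using this.symm
  refine ⟨k, MatchedPair.setHom_ext fun y => ?_⟩
  change (show X ⟶ Y from y) ≫ k = SetHom.map f y
  have hq : copowerι X (show X ⟶ Y from y) ≫ q = y := Sigma.ι_desc _ _
  have hr : copowerι X (show X ⟶ Y from y) ≫ r = SetHom.map f y := Sigma.ι_desc _ _
  rw [← hr, ← hk, ← Category.assoc, hq]

theorem select_sortMap_gen (hX : IsFreeOnOneOfEachSort X g) {Y : T.Alg} (y : S → (X ⟶ Y)) (s : S) :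
    (select hX.sortMap y).map s (g s) = (y s).map s (g s) := by
  have h := congrArg (fun f : X ⟶ Y => f.map s (g s)) ((isCopower_sigma S).fac y s)
  refine Eq.trans ?_ h
  change ((isCopower_sigma S).desc y).map s (g s, hX.sortMap.map s (g s)) = _
  rw [sortMap, lift_gen]
  rfl

theorem ifThenElse_sortMap (hX : IsFreeOnOneOfEachSort X g) {Y : T.Alg} (v : ∀ s, Y.carrier s) (y : X ⟶ Y) (s : S) :
    ifThenElse (component hX.sortMap s) y (hX.lift v) = hX.spread v s (y.map s (g s)) := by
  classical
  refine hX.hom_ext fun s' => ?_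
  rw [component_eq_select, ifThenElse_select, select_sortMap_gen]
  by_cases hs : s' = s
  · subst hs
    rw [if_pos rfl, spread_gen_self]
    exact congrArg (fun f : X ⟶ Y => f.map s' (g s')) (ifThenElse_top _ _)
  · rw [if_neg hs, hX.spread_gen_of_ne _ _ hs]
    exact (congrArg (fun f : X ⟶ Y => f.map s' (g s')) (ifThenElse_bot _ _)).trans
      (hX.lift_gen _ _)

open Classical in
/-- Every inhabited set over the matched pair of `X` comes from an algebra with inhabited
sorts. -/
theorem exists_homSet_iso (hX : IsFreeOnOneOfEachSort X g) [Nontrivial (Decision X)]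
    (W : (matchedPair X).SetOver)
    (w₀ : W.carrier) :
    ∃ Y : T.Alg, (∀ s, Nonempty (Y.carrier s)) ∧ Nonempty (homSet X Y ≅ W) := by
  obtain ⟨ε, hε⟩ := exists_copower_hom (X := X) (W := W) fun w => w
  let N : T.Alg := ∐ fun _ : W.carrier => X
  let v : ∀ s, N.carrier s := fun s => (copowerι X w₀).map s (g s)
  have hv : hX.lift v = copowerι X w₀ := hX.hom_ext fun s => by rw [lift_gen]
  let q : ∀ s, N.carrier s → W.carrier := fun s τ => SetHom.map ε (hX.spread v s τ)
  have hq : ∀ (o : T.Op) (a a' : ∀ i, N.carrier (T.dom o i)),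
      (∀ i, q _ (a i) = q _ (a' i)) → q _ (N.op o a) = q _ (N.op o a') := by
    intro o a a' h
    -- `o`, completed by an additional argument for the other sorts, as an operation on `W`
    let K : T.Alg := ∐ fun _ : Option (T.Arg o) => X
    let ρ : (∀ i, N.carrier (T.dom o i)) → (K ⟶ N) := fun a => Limits.Sigma.desc fun i =>
      i.elim (copowerι X w₀) fun i => hX.spread v _ (a i)
    have hρ₀ : ∀ a, copowerι X none ≫ ρ a = copowerι X w₀ := fun a => Sigma.ι_desc _ _
    have hρ : ∀ a i, copowerι X (some i) ≫ ρ a = hX.spread v _ (a i) := fun a i => Sigma.ι_desc _ _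
    let ω : X ⟶ K := hX.spread (fun s => (copowerι X none).map s (g s)) (T.cod o)
      (K.op o fun i => (copowerι X (some i)).map _ (g _))
    have hω : ∀ a, ω ≫ ρ a = hX.spread v _ (N.op o a) := fun a => hX.hom_ext fun s => by
      rw [Alg.comp_map]
      by_cases hs : s = T.cod o
      · subst hs
        rw [spread_gen_self, spread_gen_self, (ρ a).map_op]
        congr 1
        funext i
        rw [← Alg.comp_map, hρ, spread_gen_self]
      · rw [hX.spread_gen_of_ne _ _ hs, hX.spread_gen_of_ne _ _ hs, ← Alg.comp_map, hρ₀]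
    have hρε : (homFunctor X).map (ρ a) ≫ ε = (homFunctor X).map (ρ a') ≫ ε :=
      copower_hom_ext fun i => by
        change SetHom.map ε (copowerι X i ≫ ρ a) = SetHom.map ε (copowerι X i ≫ ρ a')
        cases i with
        | none => exact congrArg (SetHom.map ε) ((hρ₀ a).trans (hρ₀ a').symm)
        | some i =>
          exact (congrArg (SetHom.map ε) (hρ a i)).trans
            ((h i).trans (congrArg (SetHom.map ε) (hρ a' i)).symm)
    have : SetHom.map ε (ω ≫ ρ a) = SetHom.map ε (ω ≫ ρ a') :=
      congrArg (fun k : homSet X K ⟶ W => SetHom.map k ω) hρε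
    rwa [hω, hω] at this
  obtain ⟨B, p, hp, hk⟩ := Alg.exists_quotient N (fun s => Set.rangeFactorization (q s))
    (fun s => Set.rangeFactorization_surjective) fun o a a' h =>
      Subtype.ext (hq o a a' fun i => congrArg Subtype.val (h i))
  have hk' : ∀ s x y, p.map s x = p.map s y ↔ q s x = q s y := fun s x y =>
    (hk s x y).trans Subtype.ext_iff
  refine ⟨B, fun s => ⟨p.map s (v s)⟩, ?_⟩
  refine MatchedPair.nonempty_iso_of_surjective ((homFunctor X).map p) ε (fun y => ?_)
    (fun w => ⟨_, hε w⟩) fun ω ω' => ?_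
  · refine ⟨hX.lift fun s => (hp s ((show X ⟶ B from y).map s (g s))).choose, ?_⟩
    refine hX.hom_ext fun s => ?_
    change p.map s (Hom.map (hX.lift _) s (g s)) = _
    rw [lift_gen]
    exact (hp s _).choose_spec
  · have hqω : ∀ (ω : X ⟶ N) s, q s (ω.map s (g s)) =
        BSet.cond (component hX.sortMap s) (SetHom.map ε ω) w₀ := by
      intro ω s
      have := ε.map_cond (component hX.sortMap s) ω (copowerι X w₀)
      rw [hε] at this
      rw [← this]
      change SetHom.map ε _ = SetHom.map ε (ifThenElse (component hX.sortMap s) ω _)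
      rw [← hv, ifThenElse_sortMap]
    change (show X ⟶ N from ω) ≫ p = (show X ⟶ N from ω') ≫ p ↔ _
    constructor
    · intro h
      refine eq_of_agree_component hX.sortMap fun s => BSet.agree_of_cond_eq (z := w₀) ?_
      refine (hqω ω s).symm.trans (((hk' s _ _).1 ?_).trans (hqω ω' s))
      exact congrArg (fun f : X ⟶ B => f.map s (g s)) h
    · intro h
      refine hX.hom_ext fun s => (hk' s _ _).2 ((hqω ω s).trans (Eq.trans ?_ (hqω ω' s).symm))
      rw [h]

end IsFreeOnOneOfEachSort

variable [MonoidalClosed T.Alg]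

variable (X) in
/-- The functor represented by `X` on the two-valued collapse. -/
def collapseFunctor [Nontrivial (Decision X)] :
    TwoValuedCollapse T.Alg ⥤ (matchedPair X).SetOver :=
  (IsTwoValued T.Alg).ι ⋙ homFunctor X

theorem isEquivalence_collapseFunctor [Balanced T.Alg] [Nontrivial (Decision X)]
    (hX : IsFreeOnOneOfEachSort X g) : (collapseFunctor X).IsEquivalence where
  faithful :=
    ⟨fun {Y Z} k k' h => by
      ext1
      obtain hY | ⟨⟨hY⟩⟩ := nonempty_or_isInitial Y.property
      · exact hX.hom_eq_of_forall_comp_eq (fun s => (hY s).some) fun y =>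
          congrArg (fun f : homSet X Y.obj ⟶ homSet X Z.obj => SetHom.map f y) h
      · exact hY.hom_ext _ _⟩
  full :=
    ⟨fun {Y Z} f => by
      obtain hY | ⟨⟨hY⟩⟩ := nonempty_or_isInitial Y.property
      · obtain ⟨k, hk⟩ := hX.exists_map_eq (fun s => (hY s).some) f
        exact ⟨ObjectProperty.homMk k, hk⟩
      · have := isEmpty_hom_of_isInitial (X := X) hY
        exact ⟨ObjectProperty.homMk (hY.to _), MatchedPair.setHom_ext fun y =>
          this.elim y⟩⟩
  essSurj :=
    ⟨fun W => by
      obtain hW | ⟨⟨w₀⟩⟩ := isEmpty_or_nonempty W.carrier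
      · have := isEmpty_hom_of_isInitial (X := X) (initialIsInitial (C := T.Alg))
        let f : homSet X (⊥_ T.Alg) ⟶ W := homOfCond (fun y => this.elim y)
          (fun _ y => this.elim y) fun _ y => this.elim y
        have hf : IsIso f := MatchedPair.isIso_of_bijective f
          ⟨fun y => this.elim y, fun w => hW.elim w⟩
        exact ⟨⟨⊥_ T.Alg, Or.inr ⟨initialIsInitial⟩⟩, ⟨@asIso _ _ (homSet X (⊥_ T.Alg)) W f hf⟩⟩
      · obtain ⟨Y, hY, ⟨i⟩⟩ := hX.exists_homSet_iso W w₀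
        exact ⟨⟨Y, Or.inl (Alg.epi_toUnit Y hY)⟩, ⟨i⟩⟩⟩

end Theory

/-! ### The sets over a matched pair as a single-sorted variety -/

namespace MatchedPair

variable {B M : Type u} [BooleanAlgebra B] [Monoid M] (P : MatchedPair B M)

/-- The operation symbols of sets over a matched pair. -/
inductive SetOp : Type u
  | cond (b : B)
  | glue (Q : Set B) (hQ : Q ∈ P.J.covers) (hi : Q.Infinite)
  | smul (m : M)

/-- The signature of sets over a matched pair; the first argument of a binary operation has the
index `true`. -/
def setSignature : Signature PUnit.{u + 1} where
  Op := P.SetOp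
  Arg
    | .cond _ => ULift Bool
    | .glue Q _ _ => Q
    | .smul _ => PUnit
  dom _ _ := ⟨⟩
  cod _ := ⟨⟩

variable {P}

/-- The binary operation indexed by `b` of a family of sets with operations. -/
def condOp {A : PUnit.{u + 1} → Type u}
    (op : ∀ o : P.setSignature.Op, (∀ i, A (P.setSignature.dom o i)) → A (P.setSignature.cod o))
    (b : B) (x y : A ⟨⟩) : A ⟨⟩ :=
  op (.cond b) fun i : ULift Bool => bif i.down then x else y

section Terms

variable {G : PUnit.{u + 1} → Type u}

/-- The term `b(s, t)`. -/
def condTerm (b : B) (s t : P.setSignature.Term G ⟨⟩) : P.setSignature.Term G ⟨⟩ :=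
  condOp Signature.Term.app b s t

/-- The term `m • s`. -/
def smulTerm (m : M) (s : P.setSignature.Term G ⟨⟩) : P.setSignature.Term G ⟨⟩ :=
  .app (F := P.setSignature) (.smul m) fun _ => s

/-- The term for the operation of infinite arity belonging to the cover `Q`. -/
def glueTerm (Q : Set B) (hQ : Q ∈ P.J.covers) (hi : Q.Infinite)
    (s : Q → P.setSignature.Term G ⟨⟩) : P.setSignature.Term G ⟨⟩ :=
  .app (F := P.setSignature) (.glue Q hQ hi) s

variable {A : PUnit.{u + 1} → Type u}
  (op : ∀ o : P.setSignature.Op, (∀ i, A (P.setSignature.dom o i)) → A (P.setSignature.cod o))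
  (v : ∀ s, G s → A s)

theorem eval_condTerm (b : B) (s t : P.setSignature.Term G ⟨⟩) :
    (condTerm b s t).eval op v = condOp op b (s.eval op v) (t.eval op v) := by
  change op (.cond b) _ = op (.cond b) _
  congr 1
  funext ⟨i⟩
  cases i <;> rfl

theorem eval_smulTerm (m : M) (s : P.setSignature.Term G ⟨⟩) :
    (smulTerm m s).eval op v = op (.smul m) fun _ => s.eval op v := rfl

theorem eval_glueTerm (Q : Set B) (hQ : Q ∈ P.J.covers) (hi : Q.Infinite)
    (s : Q → P.setSignature.Term G ⟨⟩) :
    (glueTerm Q hQ hi s).eval op v = op (.glue Q hQ hi) fun b => (s b).eval op v := rfl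

end Terms

variable (P) in
/-- The names of the axioms of sets over a matched pair. -/
inductive SetAxiom : Type u
  | condSelf (b : B)
  | condLeft (b : B)
  | condRight (b : B)
  | condTop
  | condCompl (b : B)
  | condInf (b c : B)
  | glueConst (Q : Set B) (hQ : Q ∈ P.J.covers) (hi : Q.Infinite)
  | glueCond (Q : Set B) (hQ : Q ∈ P.J.covers) (hi : Q.Infinite)
  | condGlue (Q : Set B) (hQ : Q ∈ P.J.covers) (hi : Q.Infinite) (b : Q)
  | oneSmul
  | mulSmul (m n : M)
  | condSmul (b : B) (m n : M)
  | smulCond (m : M) (b : B)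

/-- The variables of an axiom: two families indexed by the cover or a single one for the axioms
on covers, three variables for the others. -/
@[reducible]
def SetAxiom.Var : P.SetAxiom → Type u
  | .glueCond Q _ _ => Q ⊕ Q
  | .condGlue Q _ _ _ => Q
  | _ => ULift (Fin 3)

/-- A variable of an axiom as a term. -/
def varTerm {G : PUnit.{u + 1} → Type u} (i : G ⟨⟩) : P.setSignature.Term G ⟨⟩ := .var i

theorem eval_varTerm {G A : PUnit.{u + 1} → Type u}
    (op : ∀ o : P.setSignature.Op, (∀ i, A (P.setSignature.dom o i)) → A (P.setSignature.cod o))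
    (v : ∀ s, G s → A s) (i : G ⟨⟩) : (varTerm (P := P) i).eval op v = v ⟨⟩ i := rfl

/-- The left-hand sides of the axioms. -/
def SetAxiom.lhs : ∀ e : P.SetAxiom, P.setSignature.Term (fun _ => e.Var) ⟨⟩
  | .condSelf b => condTerm b (varTerm ⟨0⟩) (varTerm ⟨0⟩)
  | .condLeft b => condTerm b (condTerm b (varTerm ⟨0⟩) (varTerm ⟨1⟩)) (varTerm ⟨2⟩)
  | .condRight b => condTerm b (varTerm ⟨0⟩) (condTerm b (varTerm ⟨1⟩) (varTerm ⟨2⟩))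
  | .condTop => condTerm ⊤ (varTerm ⟨0⟩) (varTerm ⟨1⟩)
  | .condCompl b => condTerm bᶜ (varTerm ⟨0⟩) (varTerm ⟨1⟩)
  | .condInf b c => condTerm (b ⊓ c) (varTerm ⟨0⟩) (varTerm ⟨1⟩)
  | .glueConst Q hQ hi => glueTerm Q hQ hi fun _ => varTerm ⟨0⟩
  | .glueCond Q hQ hi => glueTerm Q hQ hi fun b =>
      condTerm (b : B) (varTerm (Sum.inl b)) (varTerm (Sum.inr b))
  | .condGlue Q hQ hi b => condTerm (b : B) (glueTerm Q hQ hi fun c => varTerm c) (varTerm b)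
  | .oneSmul => smulTerm 1 (varTerm ⟨0⟩)
  | .mulSmul m n => smulTerm (m * n) (varTerm ⟨0⟩)
  | .condSmul b m n => smulTerm (P.mcond b m n) (varTerm ⟨0⟩)
  | .smulCond m b => smulTerm m (condTerm b (varTerm ⟨0⟩) (varTerm ⟨1⟩))

/-- The right-hand sides of the axioms. -/
def SetAxiom.rhs : ∀ e : P.SetAxiom, P.setSignature.Term (fun _ => e.Var) ⟨⟩
  | .condSelf _ => varTerm ⟨0⟩
  | .condLeft b => condTerm b (varTerm ⟨0⟩) (varTerm ⟨2⟩)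
  | .condRight b => condTerm b (varTerm ⟨0⟩) (varTerm ⟨2⟩)
  | .condTop => varTerm ⟨0⟩
  | .condCompl b => condTerm b (varTerm ⟨1⟩) (varTerm ⟨0⟩)
  | .condInf b c => condTerm b (condTerm c (varTerm ⟨0⟩) (varTerm ⟨1⟩)) (varTerm ⟨1⟩)
  | .glueConst _ _ _ => varTerm ⟨0⟩
  | .glueCond Q hQ hi => glueTerm Q hQ hi fun b => varTerm (Sum.inl b)
  | .condGlue _ _ _ b => varTerm b
  | .oneSmul => varTerm ⟨0⟩
  | .mulSmul m n => smulTerm m (smulTerm n (varTerm ⟨0⟩))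
  | .condSmul b m n => condTerm b (smulTerm m (varTerm ⟨0⟩)) (smulTerm n (varTerm ⟨0⟩))
  | .smulCond m b =>
      condTerm (P.star m b) (smulTerm m (varTerm ⟨0⟩)) (smulTerm m (varTerm ⟨1⟩))

variable (P) in
/-- The single-sorted equational theory of sets over a matched pair. -/
def setTheory : Theory PUnit.{u + 1} where
  toSignature := P.setSignature
  Eqn := P.SetAxiom
  ctx e _ := e.Var
  sort _ := ⟨⟩
  lhs e := e.lhs
  rhs e := e.rhs

/-- A set over a matched pair as an algebra. -/
def SetOver.toAlg (W : P.SetOver) : P.setTheory.Alg where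
  carrier _ := W.carrier
  op
    | .cond b => fun a => BSet.cond b (a ⟨true⟩) (a ⟨false⟩)
    | .glue Q hQ hi => fun a => BJSet.glue Q hQ hi a
    | .smul m => fun a => m • (show W.carrier from a ⟨⟩)
  eqn e v := by
    cases e
    case condSelf b => exact BSet.cond_self b _
    case condLeft b => exact BSet.cond_cond_left b _ _ _
    case condRight b => exact BSet.cond_cond_right b _ _ _
    case condTop => exact BSet.cond_top (B := B) _ _
    case condCompl b => exact BSet.cond_compl b _ _
    case condInf b c => exact BSet.cond_inf b c _ _
    case glueConst Q hQ hi => exact BJSet.glue_const Q hQ hi (show W.carrier from v ⟨⟩ ⟨0⟩)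
    case glueCond Q hQ hi => exact BJSet.glue_cond Q hQ hi _ _
    case condGlue Q hQ hi b => exact BJSet.cond_glue Q hQ hi _ b
    case oneSmul => exact one_smul M _
    case mulSmul m n => exact mul_smul m n _
    case condSmul b m n => exact W.cond_smul b m n _
    case smulCond m b => exact W.smul_cond m b _ _

/-- The operations of an algebra, as operations for the signature. -/
def algOp (A : P.setTheory.Alg) (o : P.setSignature.Op)
    (a : ∀ i, A.carrier (P.setSignature.dom o i)) : A.carrier (P.setSignature.cod o) :=
  A.op o a

theorem eval_axiom (A : P.setTheory.Alg) (e : P.SetAxiom) (v : e.Var → A.carrier ⟨⟩) :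
    e.lhs.eval (algOp A) (fun _ => v) = e.rhs.eval (algOp A) fun _ => v :=
  A.eqn e _

/-- An algebra as a set over a Boolean algebra. -/
@[reducible]
def bSetOfAlg (A : P.setTheory.Alg) : BSet B (A.carrier ⟨⟩) where
  cond := condOp (algOp A)
  cond_self b x := by
    have h := eval_axiom A (.condSelf b) fun _ => x
    simp only [SetAxiom.lhs, SetAxiom.rhs, eval_condTerm, eval_varTerm] at h
    exact h
  cond_cond_left b x y z := by
    have h := eval_axiom A (.condLeft b) fun i : ULift (Fin 3) => ![x, y, z] i.down
    simp only [SetAxiom.lhs, SetAxiom.rhs, eval_condTerm, eval_varTerm] at h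
    exact h
  cond_cond_right b x y z := by
    have h := eval_axiom A (.condRight b) fun i : ULift (Fin 3) => ![x, y, z] i.down
    simp only [SetAxiom.lhs, SetAxiom.rhs, eval_condTerm, eval_varTerm] at h
    exact h
  cond_top x y := by
    have h := eval_axiom A .condTop fun i : ULift (Fin 3) => ![x, y, y] i.down
    simp only [SetAxiom.lhs, SetAxiom.rhs, eval_condTerm, eval_varTerm] at h
    exact h
  cond_compl b x y := by
    have h := eval_axiom A (.condCompl b) fun i : ULift (Fin 3) => ![x, y, y] i.down
    simp only [SetAxiom.lhs, SetAxiom.rhs, eval_condTerm, eval_varTerm] at h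
    exact h
  cond_inf b c x y := by
    have h := eval_axiom A (.condInf b c) fun i : ULift (Fin 3) => ![x, y, y] i.down
    simp only [SetAxiom.lhs, SetAxiom.rhs, eval_condTerm, eval_varTerm] at h
    exact h

/-- An algebra as a set over a matched pair. -/
def setOverOfAlg (A : P.setTheory.Alg) : P.SetOver where
  carrier := A.carrier ⟨⟩
  bSet := bSetOfAlg A
  bjSet :=
    letI := bSetOfAlg A
    { glue := fun Q hQ hi x => A.op (.glue Q hQ hi) x
      glue_const := fun Q hQ hi x => eval_axiom A (.glueConst Q hQ hi) fun _ => x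
      glue_cond := fun Q hQ hi x y => by
        have h := eval_axiom A (.glueCond Q hQ hi) (Sum.elim x y)
        simp only [SetAxiom.lhs, SetAxiom.rhs, eval_condTerm, eval_glueTerm] at h
        exact h
      cond_glue := fun Q hQ hi x b => by
        have h := eval_axiom A (.condGlue Q hQ hi b) x
        simp only [SetAxiom.lhs, SetAxiom.rhs, eval_condTerm, eval_glueTerm] at h
        exact h }
  action :=
    { smul := fun m x => A.op (.smul m) fun _ => x
      one_smul := fun x => eval_axiom A .oneSmul fun _ => x
      mul_smul := fun m n x => eval_axiom A (.mulSmul m n) fun _ => x }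
  cond_smul b m n x := by
    have h := eval_axiom A (.condSmul b m n) fun _ => x
    simp only [SetAxiom.lhs, SetAxiom.rhs, eval_condTerm] at h
    exact h
  smul_cond m b x y := by
    have h := eval_axiom A (.smulCond m b) fun i : ULift (Fin 3) => ![x, y, y] i.down
    simp only [SetAxiom.lhs, SetAxiom.rhs, eval_condTerm, eval_smulTerm] at h
    exact h

variable (P) in
/-- The functor from sets over a matched pair to algebras. -/
def toAlgFunctor : P.SetOver ⥤ P.setTheory.Alg where
  obj W := W.toAlg
  map f := Theory.Hom.mk (fun _ => SetHom.map f) fun o a => by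
    cases o
    case cond b => exact f.map_cond b _ _
    case glue Q hQ hi => exact f.map_glue Q hQ hi _
    case smul m => exact f.map_smul m _

theorem condOp_eta {A : PUnit.{u + 1} → Type u}
    (op : ∀ o : P.setSignature.Op, (∀ i, A (P.setSignature.dom o i)) → A (P.setSignature.cod o))
    (b : B) (a : ULift Bool → A ⟨⟩) : condOp op b (a ⟨true⟩) (a ⟨false⟩) = op (.cond b) a := by
  unfold condOp
  congr 1
  funext ⟨i⟩
  cases i <;> rfl

/-- Every algebra comes from a set over the matched pair. -/
def algIso (A : P.setTheory.Alg) : (toAlgFunctor P).obj (setOverOfAlg A) ≅ A where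
  hom := Theory.Hom.mk (fun _ x => x) fun o a => by
    cases o
    case cond b => exact condOp_eta (algOp A) b a
    case glue Q hQ hi => rfl
    case smul m => rfl
  inv := Theory.Hom.mk (fun _ x => x) fun o a => by
    cases o
    case cond b => exact (condOp_eta (algOp A) b a).symm
    case glue Q hQ hi => rfl
    case smul m => rfl
  hom_inv_id := rfl
  inv_hom_id := rfl

instance : (toAlgFunctor P).IsEquivalence where
  faithful := ⟨fun {V W} _ _ h => setHom_ext fun x =>
    congrArg (fun k : (toAlgFunctor P).obj V ⟶ (toAlgFunctor P).obj W => k.map ⟨⟩ x) h⟩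
  full := ⟨fun f => ⟨homOfCond (f.map ⟨⟩)
    (fun b x y => f.map_op (.cond b) fun i : ULift Bool => bif i.down then x else y)
    (fun m x => f.map_op (.smul m) fun _ => x), rfl⟩⟩
  essSurj := ⟨fun A => ⟨setOverOfAlg A, ⟨algIso A⟩⟩⟩

end MatchedPair

namespace Decision

open MatchedPair

variable {C : Type v} [Category.{u} C] [CartesianMonoidalCategory C] [HasBinaryCoproducts C]
  [MonoidalClosed C] [HasCoproducts.{u} C] {X : C} [Nontrivial (Decision X)]

/-- The set of endomorphisms of `X` is free on the identity. -/
theorem existsUnique_hom (W : (matchedPair X).SetOver) (w : W.carrier) :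
    ∃! f : homSet X X ⟶ W, SetHom.map f (𝟙 X) = w := by
  refine ⟨homOfCond (fun m : X ⟶ X => endo m • w) (fun b m n => W.cond_smul b m n w)
    (fun m n => mul_smul m (endo n) w), one_smul (EndMonoid X) w, fun f hf => ?_⟩
  refine setHom_ext fun m => ?_
  have h := f.map_smul m (𝟙 X)
  rw [hf] at h
  exact (congrArg (SetHom.map f) (Category.comp_id (show X ⟶ X from m)).symm).trans h

theorem isFree_toAlg :
    Theory.IsFreeOnOneOfEachSort ((toAlgFunctor (matchedPair X)).obj (homSet X X))
      fun _ => 𝟙 X := by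
  intro Y y
  obtain ⟨f, hf, hu⟩ := existsUnique_hom (setOverOfAlg Y) (y ⟨⟩)
  refine ⟨(toAlgFunctor _).map f ≫ (algIso Y).hom, fun _ => hf, fun k hk => ?_⟩
  obtain ⟨f', hf'⟩ := (toAlgFunctor (matchedPair X)).map_surjective (k ≫ (algIso Y).inv)
  rw [← hu f' ?_, hf', Category.assoc, Iso.inv_hom_id, Category.comp_id]
  exact (congrArg (fun k : (toAlgFunctor (matchedPair X)).obj (homSet X X) ⟶ _ =>
    k.map ⟨⟩ (𝟙 X)) hf').trans (hk ⟨⟩)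

end Decision

/-! ### The two-valued collapse is cartesian closed -/

/-- A full subcategory containing the terminal object and closed under binary products inherits the
cartesian structure. Its monoidal structure is definitionally the one of
`ObjectProperty.fullMonoidalSubcategory`, for which exponentials are available. -/
@[reducible]
def cartesianFullSubcategory {C : Type v} [Category.{u} C]
    [CartesianMonoidalCategory C] (P : ObjectProperty C) [P.IsMonoidal] :
    CartesianMonoidalCategory P.FullSubcategory where
  __ := ObjectProperty.fullMonoidalSubcategory P
  isTerminalTensorUnit := .ofUniqueHom (fun X ↦ ObjectProperty.homMk (toUnit X.1))
    fun _ _ ↦ by ext; apply toUnit_unique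
  fst X Y := ObjectProperty.homMk (fst X.1 Y.1)
  snd X Y := ObjectProperty.homMk (snd X.1 Y.1)
  tensorProductIsBinaryProduct X Y :=
    BinaryFan.IsLimit.mk _ (fun f g ↦ ObjectProperty.homMk (lift f.hom g.hom))
      (fun f g => by ext1; exact lift_fst _ _) (fun f g => by ext1; exact lift_snd _ _)
      (fun f g m h h' => by
        ext1
        exact CartesianMonoidalCategory.hom_ext _ _
          ((congrArg (·.hom) h).trans (lift_fst _ _).symm)
          ((congrArg (·.hom) h').trans (lift_snd _ _).symm))
  fst_def X Y := by ext1; exact fst_def X.1 Y.1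
  snd_def X Y := by ext1; exact snd_def X.1 Y.1

namespace Theory

variable {S : Type u} {T : Theory S} [MonoidalClosed T.Alg]

theorem nonempty_isInitial_of_hom {Y Z : T.Alg} (hZ : IsInitial Z) (f : Y ⟶ Z) :
    Nonempty (IsInitial Y) :=
  have := strict_initial hZ f
  ⟨hZ.ofIso (asIso f).symm⟩

instance : (IsTwoValued T.Alg).ContainsUnit where
  prop_unit := Or.inl (by
    rw [show toUnit (𝟙_ T.Alg) = 𝟙 _ from toUnit_unique _ _]
    infer_instance)

variable [Balanced T.Alg]

instance : (IsTwoValued T.Alg).IsMonoidal where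
  prop_tensor Y Z hY hZ := by
    obtain hY | ⟨⟨hY⟩⟩ := nonempty_or_isInitial hY
    · obtain hZ | ⟨⟨hZ⟩⟩ := nonempty_or_isInitial hZ
      · exact Or.inl (Alg.epi_toUnit _ fun s => ⟨((hY s).some, (hZ s).some)⟩)
      · exact Or.inr (nonempty_isInitial_of_hom hZ (snd _ _))
    · exact Or.inr (nonempty_isInitial_of_hom hY (fst _ _))

instance : (IsTwoValued T.Alg).IsMonoidalClosed where
  prop_ihom Y Z hY hZ := by
    obtain ⟨X, g, hX⟩ := exists_isFreeOnOneOfEachSort T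
    -- a homomorphism from the free algebra to `Z ^ Y` exhibits all sorts of `Z ^ Y` as inhabited
    have key : ∀ f : Y ⊗ X ⟶ Z, IsTwoValued T.Alg ((ihom Y).obj Z) := fun f =>
      Or.inl (Alg.epi_toUnit _ fun s => ⟨(MonoidalClosed.curry f).map s (g s)⟩)
    obtain hZ | ⟨⟨hZ⟩⟩ := nonempty_or_isInitial hZ
    · exact key (snd _ _ ≫ hX.lift fun s => (hZ s).some)
    · obtain hY | ⟨⟨hY⟩⟩ := nonempty_or_isInitial hY
      · -- `Y × 0 ^ Y` is initial and projects onto `0 ^ Y`, which is therefore initial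
        obtain ⟨hI⟩ := nonempty_isInitial_of_hom hZ ((ihom.ev Y).app Z)
        have : Epi (snd Y ((ihom Y).obj Z)) :=
          Alg.epi_of_surjective _ fun s z => ⟨((hY s).some, z), rfl⟩
        have : Mono (snd Y ((ihom Y).obj Z)) := by
          rw [hI.hom_ext (snd Y ((ihom Y).obj Z)) (hI.to _)]
          exact initial_mono _ hI
        have := isIso_of_mono_of_epi (snd Y ((ihom Y).obj Z))
        exact Or.inr ⟨hI.ofIso (asIso (snd Y ((ihom Y).obj Z)))⟩
      · exact key (fst _ _ ≫ hY.to _)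

/-- Every category equivalent to the two-valued collapse is cartesian closed. -/
theorem nonempty_monoidalClosed {D : Type w} [Category.{u} D] [CartesianMonoidalCategory D]
    (e : TwoValuedCollapse T.Alg ≌ D) : Nonempty (MonoidalClosed D) := by
  let := cartesianFullSubcategory (IsTwoValued T.Alg)
  let : MonoidalClosed (TwoValuedCollapse T.Alg) :=
    ObjectProperty.fullMonoidalClosedSubcategory _
  exact ⟨cartesianClosedOfEquiv e⟩

end Theory

end

theorem proposition1 {S : Type u} (T : Theory S)
    [MonoidalClosed T.Alg] [HasPullbacks T.Alg] [HasSubobjectClassifier T.Alg]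
    (hnd : IsEmpty (IsInitial (𝟙_ T.Alg)))
    (X : T.Alg) (g : ∀ s, X.carrier s) (hX : Theory.IsFreeOnOneOfEachSort X g) :
    ∃ hXtv : IsTwoValued T.Alg X,
      (∃ (V : Theory PUnit.{u + 1}) (e : TwoValuedCollapse T.Alg ≌ V.Alg),
        Nonempty (MonoidalClosed V.Alg) ∧
        ∃ x : ∀ s, (e.functor.obj ⟨X, hXtv⟩).carrier s, Theory.IsFreeOnOneOfEachSort _ x) ∧
      (∃ (_ : BooleanAlgebra (Decision X)) (P : MatchedPair (Decision X) (EndMonoid X)),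
        P.IsDefinedFrom X ∧ Nonempty (TwoValuedCollapse T.Alg ≌ P.SetOver)) := by
  have : Balanced T.Alg := inferInstance
  have : Nontrivial (Decision X) := Theory.nontrivial_decision hnd g
  have := Theory.isEquivalence_collapseFunctor hX
  let e := (Theory.collapseFunctor X).asEquivalence
  let e' := (MatchedPair.toAlgFunctor (Decision.matchedPair X)).asEquivalence
  exact ⟨Or.inl (Theory.Alg.epi_toUnit X fun s => ⟨g s⟩),
    ⟨_, e.trans e', Theory.nonempty_monoidalClosed (e.trans e'), fun _ => 𝟙 X,
      Decision.isFree_toAlg⟩,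
    inferInstance, Decision.matchedPair X, Decision.matchedPair_isDefinedFrom X, ⟨e⟩⟩
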